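/- Let $a,b>1$ be integers and let $\Gamma$ be an Abelian group of order $ab$, written additively. A $\Gamma$-magic rectangle $\mathrm{MR}_\Gamma(a,b)$ is an $a\times b$ array whose entries are elements of $\Gamma$, each element of $\Gamma$ appearing exactly once, such that all row sums are equal to one constant $\omega\in\Gamma$ and all column sums are equal to one constant $\delta\in\Gamma$. Let $\mathcal{G}$ be the class of all finite Abelian groups that either have odd order or contain more than one involution (element of order $2$). Then a $\Gamma$-magic rectangle $\mathrm{MR}_\Gamma(a,b)$ exists if and only if $a$ and $b$ are both even or $\Gamma\in\mathcal{G}$. -/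

import Mathlib

/-- `x` is a `Γ`-magic rectangle set `MRS_Γ(a, b; c)`: a collection of `c` arrays of size `a × b`
with entries in `Γ`, in which every element of `Γ` appears exactly once over the whole collection
(so that `Γ` has order `abc`), such that all row sums in all arrays are equal to one constant `ω`
and all column sums in all arrays are equal to one constant `δ`. -/
def IsMagicRectangleSet {Γ : Type*} [AddCommGroup Γ] {a b c : ℕ}
    (x : Fin c → Matrix (Fin a) (Fin b) Γ) : Prop :=
  Function.Bijective (fun p : Fin c × Fin a × Fin b => x p.1 p.2.1 p.2.2) ∧
  (∃ ω : Γ, ∀ s i, ∑ j, x s i j = ω) ∧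
  (∃ δ : Γ, ∀ s j, ∑ i, x s i j = δ)

/-- `x` is a `Γ`-magic rectangle `MR_Γ(a, b)`: a magic rectangle set with a single array. -/
def IsMagicRectangle {Γ : Type*} [AddCommGroup Γ] {a b : ℕ}
    (x : Matrix (Fin a) (Fin b) Γ) : Prop :=
  IsMagicRectangleSet (fun _ : Fin 1 => x)

/-- Membership in the class `𝒢` of the Abelian groups that have odd order or contain more than
one involution (element of order two). -/
def InClassG (Γ : Type*) [AddCommGroup Γ] : Prop :=
  Odd (Nat.card Γ) ∨ {g : Γ | addOrderOf g = 2}.Nontrivial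

/-! Necessity. Let `a` be odd and `b` even. The sum of all elements of `Γ` equals `b • δ`, so `a`
kills it. If `Γ` had a unique involution `e`, that sum would be `e`, because all other elements
cancel against their negatives; an odd multiple of `e` is not zero.

Sufficiency, by induction on the order. For a prime `p` dividing the number of rows, take a
surjection `χ : Γ →+ ZMod p`, a rectangle on its kernel, and stack `p` translates of it. The
translations are governed by a Kotzig array, which keeps the row sums equal (`HasMagic.of_ker`).
Such arrays exist for an even number of columns, and also for odd `p` and at least two columns.
Columns are treated by transposing. What remains is `2 × 2`, `p × q` with odd primes, and `p × 2 ^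
k` with `p` an odd prime and at least two involutions.

For `p = q` the array depends on `i + j` and `i - j`. In the other odd cases `Γ` splits as `A × B`
with coprime orders, and `hasMagic_prod` reduces the task to finding permutations of `A` and of `B`
with constant sums. For `p × 2 ^ k`, if the 2-group `B` has a Klein subgroup whose quotient still
has two involutions, a rectangle over the quotient lifts (`HasMagic.of_quotient`). Otherwise `B` is
the Klein group, `(ZMod 2)³`, or `ZMod 2 × C` where `C` has a unique involution and that involution
is a double; each of these has a direct construction. -/

open Finset

/-! ### Magic arrays and their transport -/

/-- A magic rectangle whose rows and columns are indexed by arbitrary finite types. -/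
def IsMagicArray {I J Γ : Type*} [Fintype I] [Fintype J] [AddCommGroup Γ] (f : I → J → Γ) : Prop :=
  Function.Bijective (fun p : I × J => f p.1 p.2) ∧ (∃ ω, ∀ i, ∑ j, f i j = ω) ∧
    ∃ δ, ∀ j, ∑ i, f i j = δ

/-- Existence of a magic rectangle of the given dimensions. -/
def HasMagic (Γ : Type*) [AddCommGroup Γ] (a b : ℕ) : Prop :=
  ∃ f : Fin a → Fin b → Γ, IsMagicArray f

theorem IsMagicArray.hasMagic {I J Γ : Type*} [Fintype I] [Fintype J] [AddCommGroup Γ]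
    {f : I → J → Γ} (hf : IsMagicArray f) {a b : ℕ} (ha : Fintype.card I = a)
    (hb : Fintype.card J = b) : HasMagic Γ a b := by
  obtain ⟨h1, ⟨ω, h2⟩, ⟨δ, h3⟩⟩ := hf
  let eI : Fin a ≃ I := (Fintype.equivFinOfCardEq ha).symm
  let eJ : Fin b ≃ J := (Fintype.equivFinOfCardEq hb).symm
  refine ⟨fun i j => f (eI i) (eJ j), ?_, ⟨ω, fun i => ?_⟩, ⟨δ, fun j => ?_⟩⟩
  · exact h1.comp (eI.prodCongr eJ).bijective
  · rw [← h2 (eI i)]; exact eJ.sum_comp (fun j => f (eI i) j)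
  · rw [← h3 (eJ j)]; exact eI.sum_comp (fun i => f i (eJ j))

theorem HasMagic.symm {Γ : Type*} [AddCommGroup Γ] {a b : ℕ} (h : HasMagic Γ a b) :
    HasMagic Γ b a := by
  obtain ⟨f, h1, h2, h3⟩ := h
  exact ⟨fun j i => f i j, h1.comp (Equiv.prodComm _ _).bijective, h3, h2⟩

theorem HasMagic.map {Γ Δ : Type*} [AddCommGroup Γ] [AddCommGroup Δ] (e : Γ ≃+ Δ) {a b : ℕ}
    (h : HasMagic Γ a b) : HasMagic Δ a b := by
  obtain ⟨f, h1, ⟨ω, h2⟩, ⟨δ, h3⟩⟩ := h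
  refine ⟨fun i j => e (f i j), e.bijective.comp h1, ⟨e ω, fun i => ?_⟩, ⟨e δ, fun j => ?_⟩⟩
  · rw [← map_sum, h2]
  · rw [← map_sum, h3]

theorem hasMagic_iff {Γ : Type*} [AddCommGroup Γ] {a b : ℕ} :
    (∃ x : Matrix (Fin a) (Fin b) Γ, IsMagicRectangle x) ↔ HasMagic Γ a b := by
  refine exists_congr fun x => ?_
  unfold IsMagicRectangle IsMagicRectangleSet IsMagicArray
  refine and_congr ?_ (and_congr ?_ ?_)
  · rw [← Function.Bijective.of_comp_iff (fun p : Fin a × Fin b => x p.1 p.2)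
      (Equiv.uniqueProd (Fin a × Fin b) (Fin 1)).bijective]
    rfl
  · exact exists_congr fun ω => ⟨fun h i => h 0 i, fun h _ i => h i⟩
  · exact exists_congr fun ω => ⟨fun h i => h 0 i, fun h _ i => h i⟩

/-! ### Kotzig arrays and extension from a kernel -/

/-- The first `b` of the permutations `K j` form a Kotzig array: the sum of their values does not
depend on the argument. -/
def HasKotzig (n b : ℕ) : Prop :=
  ∃ (K : ℕ → Equiv.Perm (Fin n)) (s : ℕ), ∀ i, ∑ j ∈ range b, (K j i : ℕ) = s

/-- The identity and the reversal together contribute the constant `n - 1`. -/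
theorem HasKotzig.add_two {n b : ℕ} (h : HasKotzig n b) : HasKotzig n (b + 2) := by
  obtain ⟨K, s, hK⟩ := h
  refine ⟨fun j => if j < b then K j else if j = b then Equiv.refl _ else Fin.revPerm,
    s + (n - 1), fun i => ?_⟩
  rw [sum_range_succ, sum_range_succ, sum_congr rfl (g := fun j => (K j i : ℕ)), hK]
  · simp only [lt_irrefl, if_false, if_true, Equiv.refl_apply, show ¬ b + 1 < b by omega,
      show b + 1 ≠ b by omega, Fin.revPerm_apply, Fin.val_rev]
    omega
  · intro j hj
    simp only [if_pos (mem_range.1 hj)]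

theorem hasKotzig_three {n : ℕ} (hn : Odd n) : HasKotzig n 3 := by
  obtain ⟨m, rfl⟩ := hn
  -- Both maps decrease by one along each parity class of `i`, so that `i + q i + r i = 3 * m`.
  let q : Fin (2 * m + 1) → Fin (2 * m + 1) := fun i =>
    if (i : ℕ) % 2 = 0 then ⟨m - i / 2, by omega⟩ else ⟨2 * m - i / 2, by omega⟩
  let r : Fin (2 * m + 1) → Fin (2 * m + 1) := fun i =>
    if (i : ℕ) % 2 = 0 then ⟨2 * m - i / 2, by omega⟩ else ⟨m - 1 - i / 2, by omega⟩
  have hq : Function.Injective q := by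
    intro x y h
    have := x.2
    have := y.2
    simp only [q] at h
    apply Fin.ext
    split_ifs at h <;> simp only [Fin.mk.injEq] at h <;> omega
  have hr : Function.Injective r := by
    intro x y h
    have := x.2
    have := y.2
    simp only [r] at h
    apply Fin.ext
    split_ifs at h <;> simp only [Fin.mk.injEq] at h <;> omega
  refine ⟨fun j => if j = 0 then Equiv.refl _ else if j = 1 then
    Equiv.ofBijective q (Finite.injective_iff_bijective.1 hq) else
    Equiv.ofBijective r (Finite.injective_iff_bijective.1 hr), 3 * m, fun i => ?_⟩
  have := i.2
  simp only [sum_range_succ, sum_range_zero, q, r]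
  simp
  split_ifs <;> simp <;> omega

theorem hasKotzig_of_even {n b : ℕ} (hb : Even b) : HasKotzig n b := by
  obtain ⟨c, rfl⟩ := hb
  induction c with
  | zero => exact ⟨fun _ => Equiv.refl _, 0, by simp⟩
  | succ c ih => exact (show c + 1 + (c + 1) = c + c + 2 by omega) ▸ ih.add_two

theorem hasKotzig_of_odd {n b : ℕ} (hn : Odd n) (hb : 1 < b) : HasKotzig n b := by
  rcases Nat.even_or_odd b with h | ⟨c, rfl⟩
  · exact hasKotzig_of_even h
  · have : ∀ d, HasKotzig n (2 * (d + 1) + 1) := by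
      intro d
      induction d with
      | zero => exact hasKotzig_three hn
      | succ d ih => exact ih.add_two
    obtain ⟨d, rfl⟩ : ∃ d, c = d + 1 := ⟨c - 1, by omega⟩
    exact this d

/-- Magic rectangles extend from the kernel of a map onto a cyclic group. -/
theorem HasMagic.of_ker {Γ : Type*} [AddCommGroup Γ] {n a b : ℕ} [NeZero n] (χ : Γ →+ ZMod n)
    {g : Γ} (hg : χ g = 1) (hK : HasKotzig n b) (h : HasMagic χ.ker a b) :
    HasMagic Γ (n * a) b := by
  obtain ⟨f, h1, ⟨ω, h2⟩, ⟨δ, h3⟩⟩ := h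
  obtain ⟨K, s, hK⟩ := hK
  have hχ : ∀ (k : Fin n) (x : χ.ker), χ ((k : ℕ) • g + x) = ((k : ℕ) : ZMod n) := by
    intro k x
    rw [map_add, map_nsmul, hg, x.2]
    simp
  have hval : ∀ k : Fin n, (((k : ℕ) : ZMod n)).val = k := fun k =>
    ZMod.val_cast_of_lt k.2
  -- Column `j` of block `q` is shifted by `K j q` times `g`. Along a row the shifts add up to the
  -- Kotzig constant; down a column each coset of the kernel is met equally often.
  refine IsMagicArray.hasMagic (I := Fin n × Fin a) (J := Fin b)
    (f := fun p j => (K j p.1 : ℕ) • g + (f p.2 j : Γ))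
    ⟨⟨?_, ?_⟩, ⟨s • g + ω, ?_⟩, ⟨(∑ k ∈ range n, k * a) • g + n • (δ : Γ), ?_⟩⟩ (by simp) (by simp)
  · rintro ⟨⟨q, i⟩, j⟩ ⟨⟨q', i'⟩, j'⟩ hh
    simp only at hh
    have h4 := congrArg χ hh
    rw [hχ, hχ] at h4
    have h5 : (K j q) = K j' q' := by
      apply Fin.ext
      rw [← hval, h4, hval]
    rw [h5, add_right_inj, ← Subtype.ext_iff] at hh
    have h6 := @h1.1 (i, j) (i', j') hh
    simp only [Prod.mk.injEq] at h6
    obtain ⟨rfl, rfl⟩ := h6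
    rw [(K j).injective h5]
  · intro y
    have hy : y - (χ y).val • g ∈ χ.ker := by
      rw [AddMonoidHom.mem_ker, map_sub, map_nsmul, hg]
      simp
    obtain ⟨⟨i, j⟩, hij⟩ := h1.2 ⟨_, hy⟩
    refine ⟨⟨⟨(K j).symm ⟨(χ y).val, ZMod.val_lt _⟩, i⟩, j⟩, ?_⟩
    simp only at hij ⊢
    rw [hij, Equiv.apply_symm_apply]
    simp
  · rintro ⟨q, i⟩
    simp only
    rw [sum_add_distrib, ← sum_smul, ← h2 i, ← hK q, ← Fin.sum_univ_eq_sum_range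
      (fun j => (K j q : ℕ))]
    simp
  · intro j
    rw [sum_add_distrib, Fintype.sum_prod_type, Fintype.sum_prod_type]
    congr 1
    · simp only [sum_const, card_univ, Fintype.card_fin]
      rw [Equiv.sum_comp (K j) (fun q : Fin n => a • (q : ℕ) • g), ← Fin.sum_univ_eq_sum_range
        (fun k => k * a), sum_smul]
      exact sum_congr rfl fun q _ => by rw [mul_comm, mul_smul]
    · simp only [sum_const, card_univ, Fintype.card_fin, ← h3 j]
      simp

/-! ### Homomorphisms onto cyclic groups of prime order -/

theorem exists_hom_zmod_eq_one_of_module {V : Type*} [AddCommGroup V] (p : ℕ)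
    [Fact p.Prime] [Module (ZMod p) V] {g : V} (hg : g ≠ 0) :
    ∃ χ : V →+ ZMod p, χ g = 1 := by
  obtain ⟨φ, hφ⟩ := Module.Projective.exists_dual_eq_one (ZMod p) hg
  exact ⟨φ.toAddMonoidHom, hφ⟩

/-- The class of `g` is a nonzero vector of `Γ / pΓ` over `ZMod p`, so some linear functional takes
the value one on it. -/
theorem exists_hom_zmod_eq_one {Γ : Type*} [AddCommGroup Γ] (p : ℕ) [Fact p.Prime] {g : Γ}
    (hg : ∀ x : Γ, p • x ≠ g) : ∃ χ : Γ →+ ZMod p, χ g = 1 := by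
  let N := (nsmulAddMonoidHom (α := Γ) p).range
  have hQ : ∀ x : Γ ⧸ N, p • x = 0 := by
    intro x
    induction x using QuotientAddGroup.induction_on with
    | H x => exact (QuotientAddGroup.eq_zero_iff _).2 ⟨x, rfl⟩
  have hne : (QuotientAddGroup.mk' N g) ≠ 0 := by
    intro h
    obtain ⟨x, hx⟩ := (QuotientAddGroup.eq_zero_iff _).1 h
    exact hg x hx
  obtain ⟨φ, hφ⟩ := @exists_hom_zmod_eq_one_of_module _ _ p _
    (AddCommGroup.zmodModule hQ) _ hne
  exact ⟨φ.comp (QuotientAddGroup.mk' N), hφ⟩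

/-- By Cauchy's theorem multiplication by `p` is not injective, hence not surjective on a finite
group; any element outside its image serves as `g`. -/
theorem exists_hom_zmod_of_dvd_card {Γ : Type*} [AddCommGroup Γ] [Finite Γ] (p : ℕ)
    [hp : Fact p.Prime] (h : p ∣ Nat.card Γ) : ∃ (χ : Γ →+ ZMod p) (g : Γ), χ g = 1 := by
  have : ∃ g : Γ, ∀ x : Γ, p • x ≠ g := by
    by_contra! hh
    have hs : Function.Surjective (fun x : Γ => p • x) := hh
    obtain ⟨x, hx⟩ := exists_prime_addOrderOf_dvd_card' p h
    have h0 : x = 0 := (Finite.injective_iff_surjective.2 hs) (by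
      simp only [smul_zero]
      rw [← hx, addOrderOf_nsmul_eq_zero])
    rw [h0, addOrderOf_zero] at hx
    exact hp.1.one_lt.ne hx
  obtain ⟨g, hg⟩ := this
  obtain ⟨χ, hχ⟩ := exists_hom_zmod_eq_one p hg
  exact ⟨χ, g, hχ⟩

theorem card_ker_of_apply_eq_one {Γ : Type*} [AddCommGroup Γ] {n a : ℕ} [NeZero n]
    (χ : Γ →+ ZMod n) {g : Γ} (hg : χ g = 1) (h : Nat.card Γ = n * a) :
    Nat.card χ.ker = a := by
  have hs : Function.Surjective χ := fun y => ⟨y.val • g, by rw [map_nsmul, hg]; simp⟩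
  have h1 := AddSubgroup.card_mul_index χ.ker
  rw [AddSubgroup.index_ker, AddMonoidHom.range_eq_top.2 hs, AddSubgroup.card_top, Nat.card_zmod, h,
    mul_comm] at h1
  exact Nat.eq_of_mul_eq_mul_left (Nat.pos_of_neZero n) h1

/-! ### Involutions and necessity -/

theorem eq_zero_of_odd_of_nsmul {Γ : Type*} [AddCommGroup Γ] {a : ℕ} (ha : Odd a) {x : Γ}
    (h2 : x + x = 0) (h : a • x = 0) : x = 0 := by
  obtain ⟨m, rfl⟩ := ha
  rwa [add_smul, mul_comm, mul_smul, two_smul, h2, smul_zero, zero_add, one_smul] at h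

theorem addOrderOf_eq_two_iff_add_self {Γ : Type*} [AddCommGroup Γ] {x : Γ} :
    addOrderOf x = 2 ↔ x ≠ 0 ∧ x + x = 0 := by
  rw [addOrderOf_eq_prime_iff, two_smul, and_comm]

/-- The group has at least two involutions. -/
def HasTwoInvolutions (Γ : Type*) [AddCommGroup Γ] : Prop :=
  ∃ e f : Γ, e ≠ 0 ∧ f ≠ 0 ∧ e ≠ f ∧ e + e = 0 ∧ f + f = 0

theorem inClassG_iff {Γ : Type*} [AddCommGroup Γ] :
    InClassG Γ ↔ Odd (Nat.card Γ) ∨ HasTwoInvolutions Γ := by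
  refine or_congr Iff.rfl ⟨?_, ?_⟩
  · rintro ⟨e, he, f, hf, hef⟩
    obtain ⟨he0, he2⟩ := addOrderOf_eq_two_iff_add_self.1 he
    obtain ⟨hf0, hf2⟩ := addOrderOf_eq_two_iff_add_self.1 hf
    exact ⟨e, f, he0, hf0, hef, he2, hf2⟩
  · rintro ⟨e, f, he0, hf0, hef, he2, hf2⟩
    exact ⟨e, addOrderOf_eq_two_iff_add_self.2 ⟨he0, he2⟩, f, addOrderOf_eq_two_iff_add_self.2 ⟨hf0, hf2⟩, hef⟩

theorem exists_involution {Γ : Type*} [AddCommGroup Γ] [Finite Γ] (h : Even (Nat.card Γ)) :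
    ∃ e : Γ, e ≠ 0 ∧ e + e = 0 := by
  obtain ⟨x, hx⟩ := exists_prime_addOrderOf_dvd_card' 2 (even_iff_two_dvd.1 h)
  exact ⟨x, addOrderOf_eq_two_iff_add_self.1 hx⟩

theorem sum_univ_of_unique_involution {Γ : Type*} [AddCommGroup Γ] [Fintype Γ] {e : Γ}
    (he2 : e + e = 0) (hu : ∀ x : Γ, x + x = 0 → x = 0 ∨ x = e) :
    ∑ x : Γ, x = e := by
  classical
  -- With `e` replaced by zero, every nonzero term is cancelled by the one at `-x`.
  have : ∑ x : Γ, (if x = e then 0 else x) = 0 := by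
    refine sum_involution (fun x _ => -x) ?_ ?_ (fun _ _ => mem_univ _) (fun _ _ => neg_neg _)
    · intro x _
      have h1 : -x = e ↔ x = e := by
        rw [neg_eq_iff_eq_neg, neg_eq_of_add_eq_zero_left he2]
      simp only [h1]
      split_ifs <;> simp
    · intro x _ hx hn
      split_ifs at hx with hxe
      · exact hx rfl
      · rcases hu x (by nth_rewrite 1 [← hn]; simp) with h | h
        · exact hx h
        · exact hxe h
  have h2 : ∑ x : Γ, x = ∑ x : Γ, (if x = e then 0 else x) + ∑ x : Γ, (if x = e then x else 0) := by
    rw [← sum_add_distrib]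
    exact sum_congr rfl fun x _ => by split_ifs <;> simp
  rw [h2, this]
  simp

theorem hasTwoInvolutions_of_hasMagic {Γ : Type*} [AddCommGroup Γ] [Finite Γ] {a b : ℕ}
    (hΓ : Nat.card Γ = a * b) (ha : Odd a) (hb : Even b) (h : HasMagic Γ a b) :
    HasTwoInvolutions Γ := by
  have := Fintype.ofFinite Γ
  obtain ⟨e, he, he2⟩ := exists_involution (Γ := Γ) (hΓ ▸ hb.mul_left a)
  by_contra hn
  have hu : ∀ x : Γ, x + x = 0 → x = 0 ∨ x = e := by
    intro x hx
    by_contra! hh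
    exact hn ⟨e, x, he, hh.1, hh.2.symm, he2, hx⟩
  obtain ⟨f, h1, -, ⟨δ, h3⟩⟩ := h
  have hs : b • δ = e := by
    rw [← sum_univ_of_unique_involution he2 hu, ← (Equiv.ofBijective _ h1).sum_comp,
      Fintype.sum_prod_type_right]
    simp [h3]
  refine he (eq_zero_of_odd_of_nsmul ha he2 ?_)
  rw [← hs, ← mul_smul, ← hΓ, card_nsmul_eq_zero']

/-! ### The `2 × 2` case and odd squares -/

theorem hasMagic_two_two {Γ : Type*} [AddCommGroup Γ] (h : Nat.card Γ = 2 * 2) :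
    HasMagic Γ 2 2 := by
  have : Finite Γ := Nat.finite_of_card_ne_zero (by omega)
  have := Fintype.ofFinite Γ
  classical
  obtain ⟨e, he, he2⟩ := exists_involution (Γ := Γ) (h ▸ even_two.mul_left 2)
  obtain ⟨g, hg⟩ : ∃ g : Γ, g ∉ ({0, e} : Finset Γ) := by
    by_contra! hh
    have h1 : univ ⊆ ({0, e} : Finset Γ) := fun x _ => hh x
    have := card_le_card h1
    rw [card_univ, ← Nat.card_eq_fintype_card, h] at this
    have := card_le_two (a := (0 : Γ)) (b := e)
    omega
  simp only [mem_insert, mem_singleton, not_or] at hg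
  have hge : g + e ≠ 0 := fun hh => hg.2 (by
    rw [add_eq_zero_iff_eq_neg.1 hh, neg_eq_of_add_eq_zero_left he2])
  refine ⟨![![0, g], ![g + e, e]], ?_, ⟨g, ?_⟩, ⟨g + e, ?_⟩⟩
  · rw [Fintype.bijective_iff_injective_and_card]
    refine ⟨?_, by rw [← Nat.card_eq_fintype_card (α := Γ), h]; simp⟩
    rintro ⟨i, j⟩ ⟨i', j'⟩
    fin_cases i <;> fin_cases j <;> fin_cases i' <;> fin_cases j' <;>
      simp [hg.1, hg.2, he, hge, Ne.symm hg.1, Ne.symm hg.2, Ne.symm he, Ne.symm hge]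
  · intro i
    fin_cases i <;> simp [add_assoc, he2]
  · intro i
    fin_cases i <;> simp

/-- For fixed `i`, or fixed `j`, both `i + j` and `i - j` run through all of `ZMod n`; they
determine `(i, j)` because `n` is odd. The bijection `e` onto the kernel need not be additive. -/
theorem hasMagic_square {Γ : Type*} [AddCommGroup Γ] [Finite Γ] {n : ℕ} [NeZero n] (hn : Odd n)
    (χ : Γ →+ ZMod n) {g : Γ} (hg : χ g = 1) (h : Nat.card Γ = n * n) : HasMagic Γ n n := by
  have hk : Nat.card χ.ker = n := card_ker_of_apply_eq_one χ hg h
  have := Fintype.ofFinite χ.ker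
  have e : ZMod n ≃ χ.ker := Fintype.equivOfCardEq (by
    rw [ZMod.card, ← Nat.card_eq_fintype_card, hk])
  have h2 : ∀ x y : ZMod n, x + x = y + y → x = y := by
    intro x y hxy
    refine sub_eq_zero.1 (eq_zero_of_odd_of_nsmul hn ?_ (by simp))
    rw [sub_add_sub_comm, hxy, sub_self]
  have hχ : ∀ (x : ZMod n) (y : χ.ker), χ (x.val • g + y) = x := by
    intro x y
    rw [map_add, map_nsmul, hg, y.2]
    simp
  refine IsMagicArray.hasMagic (I := ZMod n) (J := ZMod n)
    (f := fun i j => (i + j).val • g + (e (i - j) : Γ))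
    ⟨?_, ⟨∑ x : ZMod n, x.val • g + ∑ x : ZMod n, (e x : Γ), fun i => ?_⟩,
     ⟨∑ x : ZMod n, x.val • g + ∑ x : ZMod n, (e x : Γ), fun j => ?_⟩⟩
    (ZMod.card n) (ZMod.card n)
  · have := Fintype.ofFinite Γ
    rw [Fintype.bijective_iff_injective_and_card]
    refine ⟨?_, by rw [← Nat.card_eq_fintype_card (α := Γ), h]; simp⟩
    rintro ⟨i, j⟩ ⟨i', j'⟩ hh
    simp only at hh
    have h4 := congrArg χ hh
    rw [hχ, hχ] at h4
    rw [h4, add_right_inj, ← Subtype.ext_iff, e.apply_eq_iff_eq] at hh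
    have h5 : i = i' := h2 _ _ (by
      calc i + i = (i + j) + (i - j) := by ring
        _ = i' + i' := by rw [h4, hh]; ring)
    subst h5
    rw [add_right_inj] at h4
    rw [h4]
  · rw [sum_add_distrib]
    congr 1
    · exact Equiv.sum_comp (Equiv.addLeft i) fun x : ZMod n => x.val • g
    · exact Equiv.sum_comp (Equiv.subLeft i) fun x : ZMod n => (e x : Γ)
  · rw [sum_add_distrib]
    congr 1
    · exact Equiv.sum_comp (Equiv.addRight j) fun x : ZMod n => x.val • g
    · exact Equiv.sum_comp (Equiv.subRight j) fun x : ZMod n => (e x : Γ)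

/-! ### Product construction and lifting along a quotient -/

/-- The product construction: column `t` consists of the pairs `(x, π x t)`, listed in the order
given by `σ t`. -/
theorem hasMagic_prod {A B : Type*} [AddCommGroup A] [AddCommGroup B] [Fintype A] [Fintype B]
    (σ : B → A → A) (π : A → B → B) (hσ : ∀ t, Function.Bijective (σ t))
    (hπ : ∀ x, Function.Bijective (π x)) (s : A) (u v : B) (h1 : ∀ x, ∑ t, σ t x = s)
    (h2 : ∀ t, ∑ x, π x t = u) (h3 : ∀ x, ∑ t, π (σ t x) t = v) {a b : ℕ}
    (ha : Nat.card A = a) (hb : Nat.card B = b) :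
    HasMagic (A × B) a b := by
  refine IsMagicArray.hasMagic (I := A) (J := B) (f := fun x t => (σ t x, π (σ t x) t))
    ⟨?_, ⟨(s, v), fun x => ?_⟩, ⟨(∑ x, x, u), fun t => ?_⟩⟩
    (by rw [← ha, Nat.card_eq_fintype_card]) (by rw [← hb, Nat.card_eq_fintype_card])
  · rw [← Finite.injective_iff_bijective]
    rintro ⟨x, t⟩ ⟨x', t'⟩ hh
    simp only [Prod.mk.injEq] at hh
    obtain ⟨h4, h5⟩ := hh
    rw [h4] at h5
    have h6 := (hπ _).1 h5
    subst h6
    rw [(hσ _).1 h4]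
  · rw [← h1 x, ← h3 x]
    exact Prod.ext (Prod.fst_sum) (Prod.snd_sum)
  · rw [← h2 t]
    refine Prod.ext (Prod.fst_sum.trans ?_) (Prod.snd_sum.trans ?_)
    · exact (Equiv.ofBijective _ (hσ t)).sum_comp fun x => x
    · exact (Equiv.ofBijective _ (hσ t)).sum_comp fun x => π x t

/-- Lifting a magic rectangle along a quotient map whose kernel carries permutations with constant
sum. -/
theorem HasMagic.of_quotient {Γ Q E : Type*} [AddCommGroup Γ] [AddCommGroup Q] [AddCommGroup E]
    [Fintype E] (φ : E →+ Γ) (hφ : Function.Injective φ) (q : Γ →+ Q)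
    (hq : Function.Surjective q) (hker : ∀ x, q x = 0 ↔ x ∈ φ.range) {a b : ℕ} (ha : 0 < a)
    (π : Fin a → E → E) (hπ : ∀ i, Function.Bijective (π i)) (c : E) (hc : ∀ t, ∑ i, π i t = c)
    (h : HasMagic Q a b) : HasMagic Γ a (Fintype.card E * b) := by
  obtain ⟨f, h1, ⟨ω, h2⟩, ⟨δ, h3⟩⟩ := h
  have hqφ : ∀ t, q (φ t) = 0 := fun t => (hker _).2 ⟨t, rfl⟩
  have hE : ∀ x, q x = 0 → Fintype.card E • x = 0 := by
    intro x hx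
    obtain ⟨t, rfl⟩ := (hker x).1 hx
    rw [← map_nsmul, card_nsmul_eq_zero, map_zero]
  choose l hl using hq
  let z : Fin a := ⟨0, ha⟩
  obtain ⟨y, hy, hysum⟩ : ∃ y : Fin a → Fin b → Γ, (∀ i j, q (y i j) = f i j) ∧
      ∀ j, ∑ i, y i j = l δ := by
    -- An arbitrary lift has column sums correct modulo the kernel; row `z` absorbs the error, which
    -- lies in the kernel.
    refine ⟨fun i j => l (f i j) + if i = z then l δ - ∑ i', l (f i' j) else 0, ?_, ?_⟩
    · intro i j
      rw [map_add, hl]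
      split_ifs
      · simp [hl, h3]
      · simp
    · intro j
      rw [sum_add_distrib]
      simp
  refine IsMagicArray.hasMagic (I := Fin a) (J := E × Fin b)
    (f := fun i p => y i p.2 + φ (π i p.1))
    ⟨⟨?_, ?_⟩, ⟨Fintype.card E • l ω + b • φ (∑ t, t), fun i => ?_⟩, ⟨l δ + φ c, ?_⟩⟩
    (by simp) (by simp)
  · rintro ⟨i, t, j⟩ ⟨i', t', j'⟩ hh
    simp only at hh
    have h4 := congrArg q hh
    rw [map_add, map_add, hqφ, hqφ, hy, hy, add_zero, add_zero] at h4
    have h5 := @h1.1 (i, j) (i', j') h4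
    simp only [Prod.mk.injEq] at h5
    obtain ⟨rfl, rfl⟩ := h5
    rw [add_right_inj, hφ.eq_iff, (hπ i).1.eq_iff] at hh
    rw [hh]
  · intro x
    obtain ⟨⟨i, j⟩, hij⟩ := h1.2 (q x)
    simp only at hij
    obtain ⟨t, ht⟩ := (hker (x - y i j)).1 (by rw [map_sub, hy, hij, sub_self])
    obtain ⟨t', rfl⟩ := (hπ i).2 t
    exact ⟨⟨i, t', j⟩, by simp [ht]⟩
  · simp only
    rw [sum_add_distrib, Fintype.sum_prod_type, Fintype.sum_prod_type]
    congr 1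
    -- The lifted row sums may differ by kernel elements, but each is repeated `Fintype.card E`
    -- times, and that multiple kills the kernel.
    · simp only [sum_const, card_univ]
      rw [← sub_eq_zero, ← smul_sub]
      refine hE _ ?_
      rw [map_sub, map_sum, hl, ← h2 i]
      simp [hy]
    · simp only [sum_const, card_univ, Fintype.card_fin]
      rw [← smul_sum, ← map_sum]
      congr 2
      exact (Equiv.ofBijective _ (hπ i)).sum_comp fun x => x
  · rintro ⟨t, j⟩
    simp only
    rw [sum_add_distrib, hysum, ← map_sum, hc]

/-! ### Weights and distinct odd primes -/

theorem zsmul_bijective_of_not_dvd {A : Type*} [AddCommGroup A] [Finite A] {p : ℕ} (hp : p.Prime)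
    (hA : Nat.card A = p) {k : ℤ} (hk : ¬ (p : ℤ) ∣ k) :
    Function.Bijective (fun x : A => k • x) := by
  rw [← Finite.injective_iff_bijective]
  intro x y hxy
  have h1 : k • (x - y) = 0 := by rw [smul_sub]; exact sub_eq_zero.2 hxy
  rw [← addOrderOf_dvd_iff_zsmul_eq_zero] at h1
  have h2 : addOrderOf (x - y) ∣ p := hA ▸ addOrderOf_dvd_natCard (x - y)
  rcases (Nat.dvd_prime hp).1 h2 with h | h
  · exact sub_eq_zero.1 (AddMonoid.addOrderOf_eq_one_iff.1 h)
  · exact absurd (h ▸ h1) hk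

theorem zsmul_bijective_of_sign {A : Type*} [AddCommGroup A] {k : ℤ} (hk : k = 1 ∨ k = -1) :
    Function.Bijective (fun x : A => k • x) := by
  rcases hk with rfl | rfl
  · simp only [one_smul]
    exact Function.bijective_id
  · simpa using (Equiv.neg A).bijective

theorem ne_neg_self_of_odd_card {A : Type*} [AddCommGroup A] (hA : Odd (Nat.card A)) {x : A}
    (hx : x ≠ 0) : x ≠ -x := fun h =>
  hx (eq_zero_of_odd_of_nsmul hA (by nth_rewrite 1 [h]; simp) card_nsmul_eq_zero')

theorem sum_univ_add_self (A : Type*) [AddCommGroup A] [Fintype A] :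
    ∑ x : A, x + ∑ x : A, x = 0 := by
  nth_rewrite 2 [← Equiv.sum_comp (Equiv.neg A) fun x => x]
  rw [← sum_add_distrib]
  exact sum_eq_zero fun x _ => add_neg_cancel x

theorem sum_univ_eq_zero_of_odd_card {A : Type*} [AddCommGroup A] [Fintype A]
    (hA : Odd (Nat.card A)) : ∑ x : A, x = 0 := by
  exact eq_zero_of_odd_of_nsmul hA (sum_univ_add_self A) card_nsmul_eq_zero'

/-- A weight on an abelian group that is `±1` away from zero, even, and of vanishing sum. -/
theorem exists_even_weight {B : Type*} [AddCommGroup B] [Fintype B] (hB : Odd (Nat.card B))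
    (hB1 : 1 < Nat.card B) {p : ℕ} (hp : p.Prime) (hp2 : Odd p) :
    ∃ k : B → ℤ, (∀ t, k (-t) = k t) ∧ ∑ t, k t = 0 ∧ (∀ t, t ≠ 0 → k t = 1 ∨ k t = -1) ∧
      ¬ (p : ℤ) ∣ k 0 := by
  classical
  -- The weight is one away from zero when `d = 0`; `d = -2` flips the sign at `t₀` and `-t₀`. The
  -- balancing values at zero differ by 4, so the odd prime `p` cannot divide both.
  obtain ⟨d, hd, hpd⟩ : ∃ d : ℤ, (d = 0 ∨ d = -2) ∧ ¬ (p : ℤ) ∣ 1 - Nat.card B - 2 * d := by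
    by_contra! hh
    have h0 := hh 0 (Or.inl rfl)
    have h2 := hh (-2) (Or.inr rfl)
    have h4 : (p : ℤ) ∣ 4 := by
      have h := dvd_sub h2 h0
      ring_nf at h
      exact h
    have h5 : p ∣ 2 ^ 2 := by exact_mod_cast h4
    have := (Nat.prime_dvd_prime_iff_eq hp Nat.prime_two).1 (hp.dvd_of_dvd_pow h5)
    subst this
    exact absurd hp2 (by decide)
  rw [Nat.card_eq_fintype_card] at hB1
  have := Fintype.one_lt_card_iff_nontrivial.1 hB1
  obtain ⟨t₀, ht₀⟩ := exists_ne (0 : B)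
  have hn := ne_neg_self_of_odd_card hB ht₀
  refine ⟨fun t => 1 + (if t = 0 then -Nat.card B - 2 * d else 0) + (if t = t₀ then d else 0) +
    (if t = -t₀ then d else 0), ?_, ?_, ?_, ?_⟩
  · intro t
    simp only [neg_eq_zero, neg_inj]
    rw [if_congr (neg_eq_iff_eq_neg (a := t) (b := t₀)) rfl rfl]
    ring
  · simp only [sum_add_distrib, sum_ite_eq', mem_univ, if_true, Nat.card_eq_fintype_card]
    simp
    ring
  · intro t ht
    simp only [ht, if_false]
    by_cases h1 : t = t₀
    · subst h1
      rw [if_pos rfl, if_neg hn]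
      rcases hd with rfl | rfl <;> simp
    · rw [if_neg h1]
      split_ifs
      · rcases hd with rfl | rfl <;> simp
      · simp
  · simp only [if_true, Ne.symm ht₀, zero_eq_neg, ht₀, if_false]
    convert hpd using 2
    ring

theorem hasMagic_prod_of_odd_primes {A B : Type*} [AddCommGroup A] [AddCommGroup B] [Finite A]
    [Finite B] {p q : ℕ} (hp : p.Prime) (hp2 : Odd p) (hq : q.Prime) (hq2 : Odd q)
    (hA : Nat.card A = p) (hB : Nat.card B = q) : HasMagic (A × B) p q := by
  have := Fintype.ofFinite A
  have := Fintype.ofFinite B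
  have hAo : Odd (Nat.card A) := hA ▸ hp2
  have hBo : Odd (Nat.card B) := hB ▸ hq2
  obtain ⟨k, hk1, hk2, hk3, hk4⟩ := exists_even_weight hBo (hB ▸ hq.one_lt) hp hp2
  obtain ⟨l, hl1, hl2, hl3, hl4⟩ := exists_even_weight hAo (hA ▸ hp.one_lt) hq hq2
  refine hasMagic_prod (fun t x => k t • x) (fun x t => l x • t) ?_ ?_ 0 0 0 ?_ ?_ ?_ hA hB
  · intro t
    rcases eq_or_ne t 0 with rfl | ht
    · exact zsmul_bijective_of_not_dvd hp hA hk4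
    · exact zsmul_bijective_of_sign (hk3 t ht)
  · intro t
    rcases eq_or_ne t 0 with rfl | ht
    · exact zsmul_bijective_of_not_dvd hq hB hl4
    · exact zsmul_bijective_of_sign (hl3 t ht)
  · intro x
    rw [← sum_smul, hk2, zero_smul]
  · intro x
    rw [← sum_smul, hl2, zero_smul]
  · intro x
    -- Evenness of `l` absorbs the sign `k t`; at `t = 0`, where `k t` need not be a sign, both
    -- sides vanish.
    have : ∀ t, l (k t • x) • t = l x • t := by
      intro t
      rcases eq_or_ne t 0 with rfl | ht
      · simp
      · rcases hk3 t ht with h | h <;> simp [h, hl1]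
    simp only [this]
    rw [← smul_sum, sum_univ_eq_zero_of_odd_card hBo, smul_zero]

/-! ### Permutations of the Klein four-group -/

/-- The Klein four-group. -/
abbrev Klein : Type := ZMod 2 × ZMod 2

/-- An automorphism of order three of the Klein four-group. -/
def Klein.rot (v : Klein) : Klein := (v.2, v.1 + v.2)

theorem Klein.rot_bijective : Function.Bijective Klein.rot := by decide

theorem Klein.rot_zero : Klein.rot 0 = 0 := by decide

theorem Klein.add_rot_add_rot (v : Klein) : v + Klein.rot v + Klein.rot (Klein.rot v) = 0 := by
  revert v; decide

theorem Klein.add_self (v : Klein) : v + v = 0 := by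
  revert v; decide

theorem Klein.sum_univ : ∑ v : Klein, v = 0 := by decide

/-- Use `rot` once, its square once and the identity elsewhere. The identity then occurs an odd
number of times, and `1 + rot + rot² = 0`. -/
theorem Klein.exists_perms {I : Type*} [Fintype I] (hI : Odd (Fintype.card I))
    (hI1 : 1 < Fintype.card I) : ∃ π : I → Klein → Klein, (∀ i, Function.Bijective (π i)) ∧
      (∀ i, π i 0 = 0) ∧ ∀ t, ∑ i, π i t = 0 := by
  classical
  obtain ⟨i, j, hij⟩ := Fintype.one_lt_card_iff.1 hI1
  refine ⟨fun x => if x = i then rot else if x = j then rot ∘ rot else id, ?_, ?_, ?_⟩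
  · intro x
    dsimp only
    split_ifs
    · exact rot_bijective
    · exact rot_bijective.comp rot_bijective
    · exact Function.bijective_id
  · intro x
    dsimp only
    split_ifs <;> simp [rot_zero]
  · intro t
    have h : ∀ x, (if x = i then rot else if x = j then rot ∘ rot else id) t =
        t + (if x = i then t + rot t else 0) + (if x = j then t + rot (rot t) else 0) := by
      intro x
      by_cases h1 : x = i
      · subst h1
        simp only [if_true, hij, if_false, ← add_assoc, add_self]
        simp
      · by_cases h2 : x = j
        · subst h2
          simp only [if_true, h1, if_false, ← add_assoc]
          simp [add_self]
        · simp [h1, h2]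
    simp only [h, sum_add_distrib, sum_ite_eq', mem_univ, if_true, sum_const, card_univ]
    obtain ⟨m, hm⟩ := hI
    have h3 : Fintype.card I • t = t := by
      rw [hm, add_smul, mul_comm, mul_smul, two_smul, add_self, smul_zero, zero_add, one_smul]
    rw [h3]
    calc t + (t + rot t) + (t + rot (rot t)) = (t + rot t + rot (rot t)) + (t + t) := by abel
      _ = 0 := by rw [add_rot_add_rot, add_self, add_zero]

theorem hasMagic_prod_klein {A : Type*} [AddCommGroup A] [Finite A] {p : ℕ} (hp : p.Prime)
    (hp2 : Odd p) (hp3 : p ≠ 3) (hA : Nat.card A = p) : HasMagic (A × Klein) p 4 := by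
  have := Fintype.ofFinite A
  have hc : Fintype.card A = p := by rw [← Nat.card_eq_fintype_card, hA]
  obtain ⟨π, h1, h2, h3⟩ := Klein.exists_perms (hc ▸ hp2) (hc ▸ hp.one_lt)
  -- The weights `-3, 1, 1, 1` have sum zero and are invertible modulo `p ≠ 3`. The exceptional
  -- weight sits at `t = 0`, which every `π x` fixes.
  refine hasMagic_prod (fun t x => (if t = 0 then (-3 : ℤ) else 1) • x) π ?_ h1 0 0 0 ?_ h3 ?_ hA
    (by simp)
  · intro t
    split_ifs
    · refine zsmul_bijective_of_not_dvd hp hA ?_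
      rw [dvd_neg]
      intro h
      exact hp3 ((Nat.prime_dvd_prime_iff_eq hp Nat.prime_three).1 (by exact_mod_cast h))
    · exact zsmul_bijective_of_sign (Or.inl rfl)
  · intro x
    rw [← sum_smul]
    have : ∑ t : Klein, (if t = 0 then (-3 : ℤ) else 1) = 0 := by decide
    rw [this, zero_smul]
  · intro x
    have : ∀ t, π ((if t = 0 then (-3 : ℤ) else 1) • x) t = π x t := by
      intro t
      split_ifs with h
      · rw [h, h2, h2]
      · simp
    simp only [this]
    rw [← Klein.sum_univ]
    exact (Equiv.ofBijective _ (h1 x)).sum_comp fun t => t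

/-- The weight `-3` vanishes modulo 3, so this case gets an explicit array. -/
theorem hasMagic_zmod_three_prod_klein : HasMagic (ZMod 3 × Klein) 3 4 := by
  refine ⟨![![(0, 0, 0), (2, 0, 1), (1, 1, 1), (0, 1, 0)],
    ![(1, 1, 0), (1, 0, 0), (0, 1, 1), (1, 0, 1)],
    ![(2, 1, 0), (0, 0, 1), (2, 0, 0), (2, 1, 1)]], ?_, ⟨0, ?_⟩, ⟨0, ?_⟩⟩
  · rw [Fintype.bijective_iff_injective_and_card]
    exact ⟨by decide, by simp [ZMod.card]⟩
  · decide
  · decide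

/-! ### Constructions from three permutations with sum zero -/

theorem exists_odd_sign {A : Type*} [AddCommGroup A] [Finite A] (hA : Odd (Nat.card A)) :
    ∃ ε : A → ℤ, (∀ x, ε x = 1 ∨ ε x = -1) ∧ ∀ x, x ≠ 0 → ε (-x) = -ε x := by
  obtain ⟨n, ⟨e⟩⟩ := Finite.exists_equiv_fin A
  refine ⟨fun x => if e x < e (-x) then 1 else -1, ?_, ?_⟩
  · intro x
    dsimp only
    split_ifs <;> simp
  · intro x hx
    have h1 : e x ≠ e (-x) := fun h => ne_neg_self_of_odd_card hA hx (e.injective h)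
    simp only [neg_neg]
    rcases lt_or_gt_of_ne h1 with h | h
    · rw [if_neg h.asymm, if_pos h]
    · rw [if_pos h, if_neg h.asymm, neg_neg]

/-- The product construction from three permutations `α`, `β`, `γ` of `B` with sum zero. -/
theorem hasMagic_prod_of_triple {A B : Type*} [AddCommGroup A] [AddCommGroup B] [Finite A]
    [Fintype B] {a b : ℕ} (hA : Nat.card A = a) (hB : Nat.card B = b) (ha : Odd a) (ha1 : 1 < a)
    (α β γ : B → B) (hα : Function.Bijective α) (hβ : Function.Bijective β)
    (hγ : Function.Bijective γ) (hsum : ∀ t, α t + β t + γ t = 0) (k : B → ℤ)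
    (hk : ∀ t, k t = 1 ∨ k t = -1) (hk0 : ∑ t, k t = 0) (hB0 : ∑ t : B, t = 0)
    (hαβ : ∑ t, (if k t = 1 then α t else β t) = 0)
    (hβα : ∑ t, (if k t = 1 then β t else α t) = 0) (hkt : ∑ t, k t • t = 0) :
    HasMagic (A × B) a b := by
  have := Fintype.ofFinite A
  classical
  have hAo : Odd (Nat.card A) := hA ▸ ha
  obtain ⟨ε, hε, hεn⟩ := exists_odd_sign hAo
  have : Nontrivial A := by
    rw [← Fintype.one_lt_card_iff_nontrivial, ← Nat.card_eq_fintype_card, hA]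
    exact ha1
  obtain ⟨x₀, hx₀⟩ := exists_ne (0 : A)
  have hn := ne_neg_self_of_odd_card hAo hx₀
  have hx₀' : -x₀ ≠ 0 := neg_ne_zero.2 hx₀
  -- The triple occupies `0`, `x₀` and `-x₀`. Elsewhere the odd sign `ε` makes the terms at `x` and
  -- `-x` cancel down a column.
  let π : A → B → B := fun x t =>
    if x = 0 then γ t else if x = x₀ then α t else if x = -x₀ then β t else ε x • t
  have hπ0 : ∀ t, π 0 t = γ t := fun t => if_pos rfl
  have hπ1 : ∀ t, π x₀ t = α t := fun t => by simp [π, hx₀]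
  have hπ2 : ∀ t, π (-x₀) t = β t := fun t => by simp [π, hx₀, hn.symm]
  have hπ3 : ∀ x t, x ≠ 0 → x ≠ x₀ → x ≠ -x₀ → π x t = ε x • t := fun x t h1 h2 h3 => by
    simp [π, h1, h2, h3]
  have hkx : ∀ t (x : A), k t • x = if k t = 1 then x else -x := by
    intro t x
    rcases hk t with h | h <;> simp [h]
  refine hasMagic_prod (fun t x => k t • x) π ?_ ?_ 0 0 0 ?_ ?_ ?_ hA hB
  · exact fun t => zsmul_bijective_of_sign (hk t)
  · intro x
    by_cases h1 : x = 0
    · subst h1; simpa only [funext hπ0] using hγ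
    by_cases h2 : x = x₀
    · subst h2; simpa only [funext hπ1] using hα
    by_cases h3 : x = -x₀
    · subst h3; simpa only [funext hπ2] using hβ
    rw [show π x = fun t => ε x • t from funext fun t => hπ3 x t h1 h2 h3]
    exact zsmul_bijective_of_sign (hε x)
  · intro x
    rw [← sum_smul, hk0, zero_smul]
  · intro t
    have h : ∀ x, π x t = (if x = 0 then γ t else 0) + (if x = x₀ then α t else 0) +
        (if x = -x₀ then β t else 0) +
        (if x = 0 ∨ x = x₀ ∨ x = -x₀ then 0 else ε x) • t := by
      intro x
      by_cases h1 : x = 0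
      · subst h1; simp [hπ0, hx₀.symm, hx₀]
      by_cases h2 : x = x₀
      · subst h2; simp [hπ1, h1, hn]
      by_cases h3 : x = -x₀
      · subst h3; simp [hπ2, h1, h2]
      simp [hπ3 x t h1 h2 h3, h1, h2, h3]
    simp only [h, sum_add_distrib, sum_ite_eq', mem_univ, if_true]
    rw [← sum_smul]
    have h0 : ∑ x : A, (if x = 0 ∨ x = x₀ ∨ x = -x₀ then 0 else ε x) = 0 := by
      have h4 : ∑ x : A, (if x = 0 ∨ x = x₀ ∨ x = -x₀ then 0 else ε x) =
          -∑ x : A, (if x = 0 ∨ x = x₀ ∨ x = -x₀ then 0 else ε x) := by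
        nth_rewrite 1 [← Equiv.sum_comp (Equiv.neg A)]
        rw [← sum_neg_distrib]
        refine sum_congr rfl fun x _ => ?_
        have h5 : (-x = 0 ∨ -x = x₀ ∨ -x = -x₀) ↔ (x = 0 ∨ x = x₀ ∨ x = -x₀) := by
          rw [neg_eq_zero, neg_inj, neg_eq_iff_eq_neg, or_comm (a := x = -x₀)]
        simp only [Equiv.neg_apply, h5]
        split_ifs with h6
        · simp
        · exact hεn x fun h => h6 (Or.inl h)
      linarith
    rw [h0, zero_smul, add_zero, ← hsum t]
    abel
  · intro x
    by_cases h1 : x = 0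
    · subst h1
      simp only [smul_zero, hπ0]
      rw [← hB0]
      exact (Equiv.ofBijective _ hγ).sum_comp fun t => t
    by_cases h2 : x = x₀
    · subst h2
      rw [← hαβ]
      refine sum_congr rfl fun t _ => ?_
      rw [hkx]
      split_ifs
      exacts [hπ1 t, hπ2 t]
    by_cases h3 : x = -x₀
    · subst h3
      rw [← hβα]
      refine sum_congr rfl fun t _ => ?_
      rw [hkx]
      split_ifs
      exacts [hπ2 t, by rw [neg_neg, hπ1]]
    · have : ∀ t, π (k t • x) t = ε x • (k t • t) := by
        intro t
        rcases hk t with h | h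
        · rw [h, one_smul, one_smul, hπ3 x t h1 h2 h3]
        · rw [h, neg_one_smul, neg_one_smul, hπ3 (-x) t (by simpa using h1)
            (fun h => h3 (by rw [← h, neg_neg])) (fun h => h2 (neg_inj.1 h)), hεn x h1, neg_smul,
            smul_neg]
      simp only [this]
      rw [← smul_sum, hkt, smul_zero]

theorem hasMagic_prod_zmod_two_pow_three {A : Type*} [AddCommGroup A] [Finite A] {a : ℕ}
    (hA : Nat.card A = a) (ha : Odd a) (ha1 : 1 < a) :
    HasMagic (A × (ZMod 2 × ZMod 2 × ZMod 2)) a 8 := by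
  -- The second map is multiplication by a root `θ` of `X³ + X + 1` in the field with eight
  -- elements, the third is multiplication by `1 + θ`.
  refine hasMagic_prod_of_triple hA (by simp) ha ha1 id
    (fun t => (t.2.2, t.1 + t.2.2, t.2.1)) (fun t => (t.1 + t.2.2, t.1 + t.2.1 + t.2.2, t.2.1 + t.2.2))
    Function.bijective_id ?_ ?_ ?_ (fun t => if t.1 = 0 then 1 else -1) ?_ ?_ ?_ ?_ ?_ ?_
  all_goals decide

theorem sum_zmod_two {M : Type*} [AddCommMonoid M] (f : ZMod 2 → M) :
    ∑ η, f η = f 0 + f 1 := Fin.sum_univ_two f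

theorem zmod_two_cases (η : ZMod 2) : η = 0 ∨ η = 1 := by
  revert η; decide

/-- The case of a direct factor of order two whose complement has a unique involution. -/
theorem hasMagic_prod_zmod_two_prod {A C : Type*} [AddCommGroup A] [AddCommGroup C] [Finite A]
    [Finite C] {a n : ℕ} (hA : Nat.card A = a) (ha : Odd a) (ha1 : 1 < a) (hC : Nat.card C = n)
    {z : C} (hz : z + z ≠ 0) (hz2 : ∀ u : C, u + u = 0 ↔ u = 0 ∨ u = z + z) :
    HasMagic (A × (ZMod 2 × C)) a (2 * n) := by
  have := Fintype.ofFinite C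
  set c := z + z with hc
  have hcc : c + c = 0 := (hz2 c).2 (Or.inr rfl)
  have hn4 : 4 ∣ n := by
    have : addOrderOf z = 2 ^ 2 := addOrderOf_eq_prime_pow (n := 1)
      (by rwa [pow_one, two_smul]) (by
        rw [show 2 ^ (1 + 1) = 2 * 2 from rfl, mul_smul, two_smul, two_smul, ← hc, hcc])
    exact hC ▸ (show (4 : ℕ) = 2 ^ 2 from rfl) ▸ this ▸ addOrderOf_dvd_natCard z
  obtain ⟨m, rfl⟩ := hn4
  obtain ⟨g, hg⟩ : ∃ g : C, ∀ u, u + u ≠ g := by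
    by_contra! hh
    have hs : Function.Surjective (fun u : C => u + u) := hh
    exact hz ((Finite.injective_iff_surjective.2 hs) (by simpa using hcc))
  -- `r` is the indicator of a set with one element from each coset of `{0, c}`. Its size `2 * m` is
  -- even because the order 4 of `z` divides `n`; hence `l` has sum zero.
  obtain ⟨r, hr, hrm⟩ : ∃ r : C → ℕ, (∀ u, r u + r (u + c) = 1) ∧ ∑ u, r u = 2 * m := by
    obtain ⟨N, ⟨e⟩⟩ := Finite.exists_equiv_fin C
    let F : C → ℕ := fun u => if e u < e (u + c) then 1 else 0
    have h1 : ∀ u, F u + F (u + c) = 1 := by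
      intro u
      have h2 : e u ≠ e (u + c) := fun h => hz (by simpa using e.injective h)
      simp only [F]
      rw [add_assoc, hcc, add_zero]
      rcases lt_or_gt_of_ne h2 with h | h
      · rw [if_pos h, if_neg h.asymm]
      · rw [if_pos h, if_neg h.asymm]
    refine ⟨F, h1, ?_⟩
    have h2 : ∑ u, (F u + F (u + c)) = ∑ _u : C, 1 := sum_congr rfl fun u _ => h1 u
    have h3 : ∑ u, F (u + c) = ∑ u, F u := Equiv.sum_comp (Equiv.addRight c) F
    rw [sum_add_distrib, h3, sum_const, card_univ, ← Nat.card_eq_fintype_card, hC,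
      smul_eq_mul] at h2
    omega
  let l : C → ZMod 2 := fun u => r u
  have hl : ∀ u, l (u + c) ≠ l u := by
    intro u h
    have h1 : l u + l (u + c) = 1 := by
      simp only [l]
      rw [← Nat.cast_add, hr, Nat.cast_one]
    rw [h, CharTwo.add_self_eq_zero] at h1
    exact zero_ne_one h1
  have hl0 : ∑ u, l u = 0 := by
    simp only [l]
    rw [← Nat.cast_sum, hrm, Nat.cast_mul]
    exact zero_mul _
  have hone : ∑ _u : C, (1 : ZMod 2) = 0 := by
    rw [sum_const, card_univ, ← Nat.card_eq_fintype_card, hC, nsmul_eq_mul, mul_one,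
      show 4 * m = 2 * (2 * m) by ring, Nat.cast_mul]
    exact zero_mul _
  have hgs : ∑ _u : C, g = 0 := by
    rw [sum_const, card_univ, ← Nat.card_eq_fintype_card, card_nsmul_eq_zero']
  have hCC := sum_univ_add_self C
  refine hasMagic_prod_of_triple hA (by rw [Nat.card_prod, Nat.card_zmod, hC]) ha ha1
    (fun t => (l t.2 + t.1, t.2)) (fun t => (t.1, t.2 + if t.1 = 0 then 0 else g))
    (fun t => (l t.2, -(t.2 + t.2) - if t.1 = 0 then 0 else g)) ?_ ?_ ?_ ?_
    (fun t => if t.1 = 0 then 1 else -1) ?_ ?_ ?_ ?_ ?_ ?_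
  · rw [← Finite.injective_iff_bijective]
    rintro ⟨η, u⟩ ⟨η', u'⟩ hh
    simp only [Prod.mk.injEq] at hh
    obtain ⟨h1, rfl⟩ := hh
    rw [add_right_inj] at h1
    rw [h1]
  · rw [← Finite.injective_iff_bijective]
    rintro ⟨η, u⟩ ⟨η', u'⟩ hh
    simp only [Prod.mk.injEq] at hh
    obtain ⟨rfl, h1⟩ := hh
    rw [add_left_inj] at h1
    rw [h1]
  · rw [← Finite.injective_iff_bijective]
    rintro ⟨η, u⟩ ⟨η', u'⟩ hh
    simp only [Prod.mk.injEq] at hh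
    obtain ⟨h1, h2⟩ := hh
    -- As `g` is not a double, the second coordinate of `γ` reveals `η`. It then gives `u` up to
    -- adding `c`, and `l` separates `u` from `u + c`.
    have key : ∀ v w : C, -(v + v) ≠ -(w + w) - g := fun v w h => hg (v - w) (by
      rw [sub_eq_add_neg, neg_eq_iff_eq_neg] at h
      calc v - w + (v - w) = (v + v) - (w + w) := by abel
        _ = g := by rw [h]; abel)
    have hη : η = η' := by
      rcases zmod_two_cases η with rfl | rfl <;> rcases zmod_two_cases η' with rfl | rfl
      · rfl
      · simp only [if_true, sub_zero, one_ne_zero, if_false] at h2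
        exact absurd h2 (key _ _)
      · simp only [if_true, sub_zero, one_ne_zero, if_false] at h2
        exact absurd h2.symm (key _ _)
      · rfl
    subst hη
    rw [sub_left_inj, neg_inj] at h2
    have h3 : (u - u') + (u - u') = 0 := by rw [sub_add_sub_comm, h2, sub_self]
    rcases (hz2 _).1 h3 with h | h
    · rw [sub_eq_zero.1 h]
    · rw [sub_eq_iff_eq_add'] at h
      rw [h] at h1
      exact absurd h1 (hl u')
  · rintro ⟨η, u⟩
    refine Prod.ext ?_ ?_
    · calc l u + η + η + l u = (l u + l u) + (η + η) := by ring
        _ = 0 := by rw [CharTwo.add_self_eq_zero, CharTwo.add_self_eq_zero, add_zero]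
    · change u + (u + _) + (-(u + u) - _) = 0
      abel
  · intro t
    split_ifs <;> simp
  · simp [Fintype.sum_prod_type, sum_zmod_two]
  · refine Prod.ext (Prod.fst_sum.trans ?_) (Prod.snd_sum.trans ?_)
    · simp only [Fintype.sum_prod_type, sum_zmod_two, hone]
      simp
    · simp only [Fintype.sum_prod_type, sum_zmod_two]
      exact hCC
  · refine Prod.ext (Prod.fst_sum.trans ?_) (Prod.snd_sum.trans ?_)
    · simp [Fintype.sum_prod_type, sum_zmod_two, hl0, hone, -sum_const]
    · simp [Fintype.sum_prod_type, sum_zmod_two, sum_add_distrib, hgs, hCC, -sum_const]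
  · refine Prod.ext (Prod.fst_sum.trans ?_) (Prod.snd_sum.trans ?_)
    · simp [Fintype.sum_prod_type, sum_zmod_two, sum_add_distrib, hl0, hone, -sum_const]
    · simp [Fintype.sum_prod_type, sum_zmod_two, hCC, -sum_const]
  · refine Prod.ext (Prod.fst_sum.trans ?_) (Prod.snd_sum.trans ?_)
    · simp [Fintype.sum_prod_type, sum_zmod_two, hone, -sum_const]
    · simp only [Fintype.sum_prod_type, sum_zmod_two]
      rw [← sum_add_distrib]
      exact sum_eq_zero fun x _ => by simp

/-! ### Splitting a group of coprime order -/

/-- By Cauchy's theorem every prime dividing the order of `A` divides `a`, so that order is coprime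
to `b`. -/
theorem card_dvd_of_coprime_of_nsmul {A : Type*} [AddCommGroup A] [Finite A] {a b : ℕ}
    (hab : a.Coprime b) (hA : ∀ x : A, a • x = 0) (h : Nat.card A ∣ a * b) : Nat.card A ∣ a := by
  refine Nat.Coprime.dvd_of_dvd_mul_right (Nat.Coprime.symm ?_) h
  refine Nat.Coprime.symm (Nat.coprime_of_dvd fun q hq hqA hqb => ?_)
  have := Fact.mk hq
  obtain ⟨x, hx⟩ := exists_prime_addOrderOf_dvd_card' q hqA
  have h1 : q ∣ a := hx ▸ addOrderOf_dvd_of_nsmul_eq_zero (hA x)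
  exact hq.one_lt.ne' (Nat.dvd_one.1 (hab ▸ Nat.dvd_gcd h1 hqb))

/-- The factors are the `a`-torsion and the `b`-torsion; Bézout coefficients split each element. -/
theorem exists_prod_addEquiv_of_coprime {Γ : Type*} [AddCommGroup Γ] [Finite Γ] {a b : ℕ}
    (hab : a.Coprime b) (h : Nat.card Γ = a * b) :
    ∃ A B : AddSubgroup Γ, Nat.card A = a ∧ Nat.card B = b ∧ Nonempty (A × B ≃+ Γ) := by
  have hpos : 0 < a * b := h ▸ Nat.card_pos
  let A : AddSubgroup Γ := (nsmulAddMonoidHom (α := Γ) a).ker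
  let B : AddSubgroup Γ := (nsmulAddMonoidHom (α := Γ) b).ker
  have hA : ∀ x : A, a • x = 0 := fun x => Subtype.ext x.2
  have hB : ∀ x : B, b • x = 0 := fun x => Subtype.ext x.2
  have hbij : Function.Bijective (A.subtype.coprod B.subtype) := by
    constructor
    · rw [injective_iff_map_eq_zero]
      rintro ⟨x, y⟩ hxy
      have h1 : (x : Γ) = -y := add_eq_zero_iff_eq_neg.1 hxy
      have h2 : a • (x : Γ) = 0 := x.2
      have h3 : b • (x : Γ) = 0 := by rw [h1, smul_neg, show b • (y : Γ) = 0 from y.2, neg_zero]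
      have h4 : addOrderOf (x : Γ) ∣ 1 := hab ▸ Nat.dvd_gcd (addOrderOf_dvd_of_nsmul_eq_zero h2)
        (addOrderOf_dvd_of_nsmul_eq_zero h3)
      have h5 : (x : Γ) = 0 := AddMonoid.addOrderOf_eq_one_iff.1 (Nat.dvd_one.1 h4)
      rw [h5, zero_eq_neg] at h1
      exact Prod.ext (Subtype.ext h5) (Subtype.ext h1)
    · intro g
      have hg : (a * b) • g = 0 := h ▸ card_nsmul_eq_zero'
      have hbez := Nat.gcd_eq_gcd_ab a b
      rw [hab] at hbez
      refine ⟨(⟨(a.gcdB b) • (b • g), ?_⟩, ⟨(a.gcdA b) • (a • g), ?_⟩), ?_⟩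
      · change a • (_ • (b • g)) = 0
        rw [smul_comm, ← mul_smul a b, hg, smul_zero]
      · change b • (_ • (a • g)) = 0
        rw [smul_comm, ← mul_smul b a, mul_comm, hg, smul_zero]
      · change (a.gcdB b) • (b • g) + (a.gcdA b) • (a • g) = g
        rw [← natCast_zsmul g b, ← natCast_zsmul g a, ← mul_smul, ← mul_smul, ← add_smul,
          mul_comm _ (b : ℤ), mul_comm _ (a : ℤ), add_comm, ← hbez]
        simp
  let e := AddEquiv.ofBijective _ hbij
  have hcard : Nat.card A * Nat.card B = a * b := by
    rw [← h, ← Nat.card_prod, Nat.card_congr e.toEquiv]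
  have hAa := card_dvd_of_coprime_of_nsmul hab hA (Dvd.intro _ hcard)
  have hBb := card_dvd_of_coprime_of_nsmul hab.symm hB
    (Dvd.intro_left _ (hcard.trans (mul_comm a b)))
  have ha := Nat.le_of_dvd (Nat.pos_of_mul_pos_right hpos) hAa
  have hb := Nat.le_of_dvd (Nat.pos_of_mul_pos_left hpos) hBb
  have hA0 : 0 < Nat.card A := Nat.card_pos
  have hB0 : 0 < Nat.card B := Nat.card_pos
  exact ⟨A, B, by nlinarith, by nlinarith, ⟨e⟩⟩

/-! ### Klein subgroups and 2-groups with several involutions -/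

/-- The homomorphism from the group of order two given by an involution. -/
def zmodTwoHom {Γ : Type*} [AddCommGroup Γ] (e : Γ) (he : e + e = 0) : ZMod 2 →+ Γ :=
  ZMod.lift 2 ⟨zmultiplesHom Γ e, by simp [two_smul, he]⟩

theorem zmodTwoHom_one {Γ : Type*} [AddCommGroup Γ] {e : Γ} (he : e + e = 0) :
    zmodTwoHom e he 1 = e := by
  have := ZMod.lift_coe 2 (⟨zmultiplesHom Γ e, by simp [two_smul, he]⟩ :
    {f : ℤ →+ Γ // f (2 : ℕ) = 0}) 1
  rw [Int.cast_one] at this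
  exact this.trans (one_zsmul e)

theorem exists_klein_hom {Γ : Type*} [AddCommGroup Γ] {e f : Γ} (he : e ≠ 0) (hf : f ≠ 0)
    (hef : e ≠ f) (he2 : e + e = 0) (hf2 : f + f = 0) :
    ∃ φ : Klein →+ Γ, Function.Injective φ ∧
      ∀ x, x ∈ φ.range ↔ x = 0 ∨ x = e ∨ x = f ∨ x = e + f := by
  let φ : Klein →+ Γ := (zmodTwoHom e he2).coprod (zmodTwoHom f hf2)
  have h10 : φ (1, 0) = e := by simp [φ, zmodTwoHom_one]
  have h01 : φ (0, 1) = f := by simp [φ, zmodTwoHom_one]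
  have h11 : φ (1, 1) = e + f := by simp [φ, zmodTwoHom_one]
  have h00 : φ (0, 0) = 0 := by simp [φ]
  have hef' : e + f ≠ 0 := fun h => hef (by
    rw [add_eq_zero_iff_eq_neg.1 h, neg_eq_of_add_eq_zero_left hf2])
  have hcases : ∀ v : Klein, v = (0, 0) ∨ v = (1, 0) ∨ v = (0, 1) ∨ v = (1, 1) := by decide
  refine ⟨φ, ?_, fun x => ⟨?_, ?_⟩⟩
  · rw [injective_iff_map_eq_zero]
    intro v hv
    rcases hcases v with rfl | rfl | rfl | rfl
    · rfl
    · exact absurd (h10 ▸ hv) he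
    · exact absurd (h01 ▸ hv) hf
    · exact absurd (h11 ▸ hv) hef'
  · rintro ⟨v, rfl⟩
    rcases hcases v with rfl | rfl | rfl | rfl
    · exact Or.inl h00
    · exact Or.inr (Or.inl h10)
    · exact Or.inr (Or.inr (Or.inl h01))
    · exact Or.inr (Or.inr (Or.inr h11))
  · rintro (rfl | rfl | rfl | rfl)
    exacts [⟨_, h00⟩, ⟨_, h10⟩, ⟨_, h01⟩, ⟨_, h11⟩]

/-- Some quotient by a Klein four-group still has two involutions. -/
def HasKleinQuotient (B : Type*) [AddCommGroup B] : Prop :=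
  ∃ φ : Klein →+ B, Function.Injective φ ∧ HasTwoInvolutions (B ⧸ φ.range)

theorem hasKleinQuotient_of_mem {B : Type*} [AddCommGroup B] {e f x y : B} (he : e ≠ 0)
    (hf : f ≠ 0) (hef : e ≠ f) (he2 : e + e = 0) (hf2 : f + f = 0)
    (hx : ¬ (x = 0 ∨ x = e ∨ x = f ∨ x = e + f)) (hy : ¬ (y = 0 ∨ y = e ∨ y = f ∨ y = e + f))
    (hxy : ¬ (x - y = 0 ∨ x - y = e ∨ x - y = f ∨ x - y = e + f))
    (hx2 : x + x = 0 ∨ x + x = e ∨ x + x = f ∨ x + x = e + f)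
    (hy2 : y + y = 0 ∨ y + y = e ∨ y + y = f ∨ y + y = e + f) : HasKleinQuotient B := by
  obtain ⟨φ, hφ, hr⟩ := exists_klein_hom he hf hef he2 hf2
  have h0 : ∀ x : B, QuotientAddGroup.mk' φ.range x = 0 ↔ x = 0 ∨ x = e ∨ x = f ∨ x = e + f :=
    fun x => by
      rw [← hr]
      exact QuotientAddGroup.eq_zero_iff x
  refine ⟨φ, hφ, QuotientAddGroup.mk' φ.range x, QuotientAddGroup.mk' φ.range y,
    fun h => hx ((h0 _).1 h), fun h => hy ((h0 _).1 h), fun h => hxy ((h0 _).1 ?_), ?_, ?_⟩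
  · rw [map_sub, h, sub_self]
  · rw [← map_add]; exact (h0 _).2 hx2
  · rw [← map_add]; exact (h0 _).2 hy2

theorem nonempty_addEquiv_of_card_eq {V W : Type*} [AddCommGroup V] [AddCommGroup W] (p : ℕ)
    [Fact p.Prime] [Module (ZMod p) V] [Module (ZMod p) W] [Finite V] [Finite W]
    (h : Nat.card V = Nat.card W) : Nonempty (V ≃+ W) := by
  have h1 := Module.natCard_eq_pow_finrank (K := ZMod p) (V := V)
  have h2 := Module.natCard_eq_pow_finrank (K := ZMod p) (V := W)
  rw [h, h2, Nat.card_zmod] at h1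
  obtain ⟨e⟩ := FiniteDimensional.nonempty_linearEquiv_of_finrank_eq
    (Nat.pow_right_injective (Fact.out : p.Prime).two_le h1.symm)
  exact ⟨e.toAddEquiv⟩

theorem exists_addEquiv_zmod_two_prod {B : Type*} [AddCommGroup B] (χ : B →+ ZMod 2) {f : B}
    (hf : f + f = 0) (hχ : χ f = 1) : Nonempty (ZMod 2 × χ.ker ≃+ B) := by
  refine ⟨AddEquiv.ofBijective ((zmodTwoHom f hf).coprod χ.ker.subtype) ⟨?_, ?_⟩⟩
  · rw [injective_iff_map_eq_zero]
    rintro ⟨η, u⟩ h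
    change zmodTwoHom f hf η + u = 0 at h
    rcases zmod_two_cases η with rfl | rfl
    · rw [map_zero, zero_add] at h
      exact Prod.ext rfl (Subtype.ext h)
    · rw [zmodTwoHom_one] at h
      have h1 := congrArg χ h
      rw [map_add, hχ, u.2, map_zero] at h1
      exact absurd h1 (by decide)
  · intro t
    rcases zmod_two_cases (χ t) with h | h
    · exact ⟨(0, ⟨t, h⟩), by simp⟩
    · refine ⟨(1, ⟨t - f, ?_⟩), ?_⟩
      · rw [AddMonoidHom.mem_ker, map_sub, h, hχ, sub_self]
      · change zmodTwoHom f hf 1 + (t - f) = t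
        rw [zmodTwoHom_one, add_sub_cancel]

/-- Divide by the Klein group spanned by `z + z` and a further involution `f`: the class of `z` is
an involution. If there is no second one, the structure of `B` is forced. -/
theorem HasTwoInvolutions.cases_of_order_four {B : Type*} [AddCommGroup B]
    (h : HasTwoInvolutions B) {z : B} (hz : z + z ≠ 0) (hz4 : (z + z) + (z + z) = 0) :
    HasKleinQuotient B ∨ ∃ (C : AddSubgroup B) (z : C), Nonempty (ZMod 2 × C ≃+ B) ∧
      z + z ≠ 0 ∧ ∀ u : C, u + u = 0 ↔ u = 0 ∨ u = z + z := by
  by_cases hK : HasKleinQuotient B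
  · exact Or.inl hK
  right
  obtain ⟨f, hf, hef, hf2⟩ : ∃ f : B, f ≠ 0 ∧ z + z ≠ f ∧ f + f = 0 := by
    obtain ⟨e₁, e₂, h1, h2, h12, h3, h4⟩ := h
    by_cases h5 : z + z = e₁
    · exact ⟨e₂, h2, h5 ▸ h12, h4⟩
    · exact ⟨e₁, h1, h5, h3⟩
  have hsum : (z + z + f) + (z + z + f) = 0 := by
    rw [add_add_add_comm, hz4, hf2, add_zero]
  have hzf : z + z + f ≠ 0 := fun h => hef (by
    rw [add_eq_zero_iff_eq_neg.1 h, neg_eq_of_add_eq_zero_left hf2])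
  have hne : ∀ w : B, w + w ≠ 0 → ¬ (w = 0 ∨ w = z + z ∨ w = f ∨ w = z + z + f) := by
    rintro w hw (rfl | rfl | rfl | rfl)
    exacts [hw (add_zero 0), hw hz4, hw hf2, hw hsum]
  -- An involution `y` outside the Klein group would give a second involution of the quotient,
  -- distinct from the class of `z`.
  have htor : ∀ y : B, y + y = 0 → y = 0 ∨ y = z + z ∨ y = f ∨ y = z + z + f := by
    intro y hy
    by_contra hn
    refine hK (hasKleinQuotient_of_mem hz hf hef hz4 hf2 (hne z hz) hn (hne _ ?_)
      (Or.inr (Or.inl rfl)) (Or.inl hy))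
    rw [sub_add_sub_comm, hy, sub_zero]
    exact hz
  -- So would a half `w` of `f`. Hence `f` is not a double, and a character with value one at `f`
  -- splits off its span.
  have hdiv : ∀ w : B, w + w ≠ f := by
    intro w hw
    refine hK (hasKleinQuotient_of_mem hz hf hef hz4 hf2 (hne z hz) (hne w (hw ▸ hf)) (hne _ ?_)
      (Or.inr (Or.inl rfl)) (Or.inr (Or.inr (Or.inl hw))))
    rw [sub_add_sub_comm, hw]
    exact sub_ne_zero.2 hef
  obtain ⟨χ, hχ⟩ := exists_hom_zmod_eq_one 2 (g := f) (fun w => by rw [two_smul]; exact hdiv w)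
  have hχe : χ (z + z) = 0 := by rw [map_add, CharTwo.add_self_eq_zero]
  -- If `z` is not in the kernel, adding `f` moves it there without changing its double.
  obtain ⟨w, hw, hwz⟩ : ∃ w, χ w = 0 ∧ w + w = z + z := by
    rcases zmod_two_cases (χ z) with h0 | h1
    · exact ⟨z, h0, rfl⟩
    · refine ⟨z + f, ?_, ?_⟩
      · rw [map_add, h1, hχ, CharTwo.add_self_eq_zero]
      · rw [add_add_add_comm, hf2, add_zero]
  refine ⟨χ.ker, ⟨w, hw⟩, exists_addEquiv_zmod_two_prod χ hf2 hχ, ?_, ?_⟩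
  · intro h0
    exact hz (hwz ▸ congrArg Subtype.val h0)
  · intro u
    constructor
    · intro hu
      have hχu : χ u = 0 := u.2
      rcases htor u (congrArg Subtype.val hu) with h0 | h0 | h0 | h0
      · exact Or.inl (Subtype.ext h0)
      · exact Or.inr (Subtype.ext (h0.trans hwz.symm))
      · rw [h0, hχ] at hχu
        exact absurd hχu one_ne_zero
      · rw [h0, map_add, hχe, zero_add, hχ] at hχu
        exact absurd hχu one_ne_zero
    · rintro (rfl | rfl)
      · exact add_zero 0
      · refine Subtype.ext ?_
        change (w + w) + (w + w) = 0
        rw [hwz, hz4]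

theorem HasTwoInvolutions.card_le_of_add_self {B : Type*} [AddCommGroup B] [Finite B]
    (h : HasTwoInvolutions B) (h2 : ∀ x : B, x + x = 0) :
    HasKleinQuotient B ∨ Nat.card B ≤ 8 := by
  classical
  have := Fintype.ofFinite B
  by_contra! hh
  obtain ⟨hK, hcard⟩ := hh
  obtain ⟨e, f, he, hf, hef, he2, hf2⟩ := h
  have hex : ∀ s : Finset B, s.card ≤ 8 → ∃ x, x ∉ s := by
    intro s hs
    by_contra! hh
    have := card_le_card (show univ ⊆ s from fun x _ => hh x)
    rw [card_univ, ← Nat.card_eq_fintype_card] at this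
    omega
  obtain ⟨x, hx⟩ := hex {0, e, f, e + f} (card_le_four.trans (by norm_num))
  -- The excluded elements fill the Klein group and the coset of `x`, at most eight in all; beyond
  -- them lies a second nonzero class.
  obtain ⟨y, hy⟩ := hex ({0, e, f, e + f} ∪ {x, x - e, x - f, x - (e + f)})
    ((card_union_le _ _).trans (add_le_add card_le_four card_le_four))
  simp only [mem_union, mem_insert, mem_singleton, not_or] at hx hy
  refine hK (hasKleinQuotient_of_mem (x := x) (y := y) he hf hef he2 hf2 (by tauto) (by tauto) ?_
    (Or.inl (h2 x)) (Or.inl (h2 y)))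
  rintro (h | h | h | h)
  · exact hy.2.1 (sub_eq_zero.1 h).symm
  · exact hy.2.2.1 (by rw [← h]; abel)
  · exact hy.2.2.2.1 (by rw [← h]; abel)
  · exact hy.2.2.2.2 (by rw [← h]; abel)

theorem exists_order_four_or_add_self {B : Type*} [AddCommGroup B] {k : ℕ}
    (h : ∀ x : B, 2 ^ k • x = 0) :
    (∃ z : B, z + z ≠ 0 ∧ (z + z) + (z + z) = 0) ∨ ∀ x : B, x + x = 0 := by
  by_contra! hh
  obtain ⟨h4, x, hx⟩ := hh
  have : ∀ n, 2 ^ n • (x + x) ≠ 0 := by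
    intro n
    induction n with
    | zero => simpa using hx
    | succ n ih =>
      rw [smul_add] at ih
      have := h4 _ ih
      rwa [pow_succ, mul_smul, two_smul, smul_add, smul_add]
  exact this k (h _)

theorem HasTwoInvolutions.four_dvd_card {B : Type*} [AddCommGroup B] (h : HasTwoInvolutions B) :
    4 ∣ Nat.card B := by
  obtain ⟨e, f, he, hf, hef, he2, hf2⟩ := h
  obtain ⟨φ, hφ, -⟩ := exists_klein_hom he hf hef he2 hf2
  have := AddSubgroup.card_dvd_of_injective φ hφ
  simpa using this

theorem HasTwoInvolutions.cases {B : Type*} [AddCommGroup B] [Finite B] {k : ℕ}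
    (hB : Nat.card B = 2 ^ k) (h : HasTwoInvolutions B) :
    HasKleinQuotient B ∨ Nonempty (Klein ≃+ B) ∨ Nonempty ((ZMod 2 × ZMod 2 × ZMod 2) ≃+ B) ∨
      ∃ (C : AddSubgroup B) (z : C), Nonempty (ZMod 2 × C ≃+ B) ∧
        z + z ≠ 0 ∧ ∀ u : C, u + u = 0 ↔ u = 0 ∨ u = z + z := by
  rcases exists_order_four_or_add_self (B := B) (k := k)
    (fun x => hB ▸ card_nsmul_eq_zero') with ⟨z, hz, hz4⟩ | h2
  · rcases h.cases_of_order_four hz hz4 with h1 | h1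
    · exact Or.inl h1
    · exact Or.inr (Or.inr (Or.inr h1))
  · rcases h.card_le_of_add_self h2 with h1 | h1
    · exact Or.inl h1
    · have h4 := h.four_dvd_card
      have hpos : 0 < Nat.card B := Nat.card_pos
      let M := AddCommGroup.zmodModule (n := 2) (G := B) (fun x => by rw [two_smul, h2])
      have h48 : Nat.card B = 4 ∨ Nat.card B = 8 := by omega
      rcases h48 with h5 | h5
      · exact Or.inr (Or.inl (@nonempty_addEquiv_of_card_eq Klein B _ _ 2 _ _ M _ _ (by simp [h5])))
      · exact Or.inr (Or.inr (Or.inl (@nonempty_addEquiv_of_card_eq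
          (ZMod 2 × ZMod 2 × ZMod 2) B _ _ 2 _ _ M _ _ (by simp [h5]))))

-- Inductions on the order and the final equivalence

universe u

/-- Reduction of the existence of a magic rectangle to a subgroup of prime index. -/
theorem hasMagic_of_prime_dvd {Γ : Type u} [AddCommGroup Γ] [Finite Γ] {p a b : ℕ} (hp : p.Prime)
    (hΓ : Nat.card Γ = p * a * b) (hK : HasKotzig p b)
    (ih : ∀ χ : Γ →+ ZMod p, Nat.card χ.ker = a * b → HasMagic χ.ker a b) :
    HasMagic Γ (p * a) b := by
  have := Fact.mk hp
  rw [mul_assoc] at hΓ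
  obtain ⟨χ, g, hg⟩ := exists_hom_zmod_of_dvd_card p (Dvd.intro _ hΓ.symm)
  exact HasMagic.of_ker χ hg hK (ih χ (card_ker_of_apply_eq_one χ hg hΓ))

theorem exists_prime_mul_of_not_prime {a : ℕ} (ha : 1 < a) (h : ¬ a.Prime) :
    ∃ p c, p.Prime ∧ 1 < c ∧ a = p * c := by
  obtain ⟨c, hc⟩ := a.minFac_dvd
  have hp := Nat.minFac_prime ha.ne'
  refine ⟨a.minFac, c, hp, ?_, hc⟩
  rcases c with _ | _ | c
  · omega
  · exact absurd (by rw [hc]; simpa using hp) h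
  · omega

theorem hasMagic_of_even_even (n : ℕ) : ∀ (Γ : Type u) [AddCommGroup Γ] (a b : ℕ), a * b = n →
    Even a → Even b → 0 < a → 0 < b → Nat.card Γ = a * b → HasMagic Γ a b := by
  induction n using Nat.strong_induction_on with
  | _ n ih =>
    have step : ∀ (Γ : Type u) [AddCommGroup Γ] (a b : ℕ), a * b = n → Even a → Even b → 2 < a →
        0 < b → Nat.card Γ = a * b → HasMagic Γ a b := by
      intro Γ _ a b hn ha hb ha2 hb0 hΓ
      have : Finite Γ := Nat.finite_of_card_ne_zero (hΓ ▸ (Nat.mul_pos (by omega) hb0).ne')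
      obtain ⟨c, rfl⟩ := ha
      -- The prime is taken from half of `a`, so the remaining factor `d + d` stays even.
      have hp := Nat.minFac_prime (n := c) (by omega)
      obtain ⟨d, hd⟩ := c.minFac_dvd
      generalize c.minFac = p at hp hd
      subst hd
      have hd0 : 0 < d := Nat.pos_of_ne_zero (by rintro rfl; simp at ha2)
      rw [show p * d + p * d = p * (d + d) by ring] at hn hΓ ⊢
      refine hasMagic_of_prime_dvd hp hΓ (hasKotzig_of_even hb) fun χ hχ =>
        ih ((d + d) * b) ?_ χ.ker (d + d) b rfl ⟨d, rfl⟩ hb (by omega) hb0 hχ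
      rw [← hn, mul_assoc]
      exact lt_mul_left (by positivity) hp.one_lt
    intro Γ _ a b hn ha hb ha0 hb0 hΓ
    by_cases ha2 : 2 < a
    · exact step Γ a b hn ha hb ha2 hb0 hΓ
    by_cases hb2 : 2 < b
    · exact (step Γ b a (by rwa [mul_comm]) hb ha hb2 ha0 (by rwa [mul_comm])).symm
    obtain ⟨c, rfl⟩ := ha
    obtain ⟨d, rfl⟩ := hb
    obtain rfl : c = 1 := by omega
    obtain rfl : d = 1 := by omega
    exact hasMagic_two_two hΓ

theorem hasMagic_of_odd_odd (n : ℕ) : ∀ (Γ : Type u) [AddCommGroup Γ] (a b : ℕ), a * b = n →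
    Odd a → Odd b → 1 < a → 1 < b → Nat.card Γ = a * b → HasMagic Γ a b := by
  induction n using Nat.strong_induction_on with
  | _ n ih =>
    have step : ∀ (Γ : Type u) [AddCommGroup Γ] (a b : ℕ), a * b = n → Odd a → Odd b → 1 < a →
        1 < b → ¬ a.Prime → Nat.card Γ = a * b → HasMagic Γ a b := by
      intro Γ _ a b hn ha hb ha1 hb1 hap hΓ
      have : Finite Γ := Nat.finite_of_card_ne_zero
        (hΓ ▸ (Nat.mul_pos (by omega) (by omega : 0 < b)).ne')
      obtain ⟨p, d, hp, hd1, rfl⟩ := exists_prime_mul_of_not_prime ha1 hap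
      obtain ⟨hpo, hdo⟩ := Nat.odd_mul.1 ha
      refine hasMagic_of_prime_dvd hp hΓ (hasKotzig_of_odd hpo hb1) fun χ hχ =>
        ih (d * b) ?_ χ.ker d b rfl hdo hb hd1 hb1 hχ
      rw [← hn, mul_assoc]
      exact lt_mul_left (by positivity) hp.one_lt
    intro Γ _ a b hn ha hb ha1 hb1 hΓ
    by_cases hap : a.Prime
    · by_cases hbp : b.Prime
      · have : Finite Γ := Nat.finite_of_card_ne_zero
          (hΓ ▸ (Nat.mul_pos (by omega) (by omega : 0 < b)).ne')
        by_cases hab : a = b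
        · subst hab
          have := Fact.mk hap
          obtain ⟨χ, g, hg⟩ := exists_hom_zmod_of_dvd_card (Γ := Γ) a (Dvd.intro _ hΓ.symm)
          exact hasMagic_square ha χ hg hΓ
        · obtain ⟨A, B, hA, hB, ⟨e⟩⟩ :=
            exists_prod_addEquiv_of_coprime ((Nat.coprime_primes hap hbp).2 hab) hΓ
          exact (hasMagic_prod_of_odd_primes hap ha hbp hb hA hB).map e
      · exact (step Γ b a (by rwa [mul_comm]) hb ha hb1 ha1 hbp (by rwa [mul_comm])).symm
    · exact step Γ a b hn ha hb ha1 hb1 hap hΓ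

/-- A homomorphism into a group of odd order kills every involution. -/
theorem HasTwoInvolutions.ker {Γ : Type*} [AddCommGroup Γ] (h : HasTwoInvolutions Γ) {n : ℕ}
    (hn : Odd n) (χ : Γ →+ ZMod n) : HasTwoInvolutions χ.ker := by
  have hχ : ∀ x : Γ, x + x = 0 → χ x = 0 := fun x hx =>
    eq_zero_of_odd_of_nsmul hn (by rw [← map_add, hx, map_zero]) (by simp)
  obtain ⟨e, f, he, hf, hef, he2, hf2⟩ := h
  exact ⟨⟨e, hχ e he2⟩, ⟨f, hχ f hf2⟩, fun h => he (congrArg Subtype.val h),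
    fun h => hf (congrArg Subtype.val h), fun h => hef (congrArg Subtype.val h),
    Subtype.ext he2, Subtype.ext hf2⟩

theorem HasTwoInvolutions.of_injective {Γ Δ : Type*} [AddCommGroup Γ] [AddCommGroup Δ]
    (h : HasTwoInvolutions Γ) (φ : Γ →+ Δ) (hφ : Function.Injective φ) : HasTwoInvolutions Δ := by
  obtain ⟨e, f, he, hf, hef, he2, hf2⟩ := h
  exact ⟨φ e, φ f, (map_ne_zero_iff φ hφ).2 he, (map_ne_zero_iff φ hφ).2 hf, hφ.ne hef,
    by rw [← map_add, he2, map_zero], by rw [← map_add, hf2, map_zero]⟩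

theorem HasTwoInvolutions.of_prod_odd {A B : Type*} [AddCommGroup A] [AddCommGroup B]
    (h : HasTwoInvolutions (A × B)) (hA : Odd (Nat.card A)) : HasTwoInvolutions B := by
  have h1 : ∀ x : A × B, x + x = 0 → x.1 = 0 := fun x hx =>
    eq_zero_of_odd_of_nsmul hA (congrArg Prod.fst hx) card_nsmul_eq_zero'
  obtain ⟨e, f, he, hf, hef, he2, hf2⟩ := h
  exact ⟨e.2, f.2, fun h => he (Prod.ext (h1 e he2) h), fun h => hf (Prod.ext (h1 f hf2) h),
    fun h => hef (Prod.ext ((h1 e he2).trans (h1 f hf2).symm) h), congrArg Prod.snd he2,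
    congrArg Prod.snd hf2⟩

/-- The case of a prime number of rows and a power of two columns, assuming that the groups
obtained by dividing out a Klein four-group have been dealt with. -/
theorem hasMagic_prod_of_prime_of_two_pow {A B : Type u} [AddCommGroup A] [AddCommGroup B]
    [Finite A] [Finite B] {p k : ℕ} (hp : p.Prime) (hpo : Odd p) (hA : Nat.card A = p)
    (hB : Nat.card B = 2 ^ k) (hinv : HasTwoInvolutions B)
    (ih : ∀ (Q : Type u) [AddCommGroup Q] (c : ℕ), 2 ^ k = 4 * c → Nat.card Q = p * c →
      HasTwoInvolutions Q → HasMagic Q p c) : HasMagic (A × B) p (2 ^ k) := by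
  rcases hinv.cases hB with ⟨φ, hφ, hQ⟩ | ⟨⟨e⟩⟩ | ⟨⟨e⟩⟩ | ⟨C, z, ⟨e⟩, hz, hz2⟩
  · have hcard := AddSubgroup.card_eq_card_quotient_mul_card_addSubgroup φ.range
    rw [← Nat.card_congr (φ.ofInjective hφ).toEquiv, hB] at hcard
    have h4 : Nat.card Klein = 4 := by simp
    rw [h4, mul_comm] at hcard
    have hQm : HasMagic (A × (B ⧸ φ.range)) p (Nat.card (B ⧸ φ.range)) :=
      ih _ _ hcard (by rw [Nat.card_prod, hA])
        (hQ.of_injective (AddMonoidHom.inr A _) fun x y h => congrArg Prod.snd h)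
    have hpc : Fintype.card (Fin p) = p := Fintype.card_fin p
    obtain ⟨π, h1, -, h3⟩ := Klein.exists_perms (I := Fin p) (hpc.symm ▸ hpo)
      (hpc.symm ▸ hp.one_lt)
    -- The quotient is by `0 × φ.range`; each column over it becomes four columns, using `p`
    -- permutations of the Klein group with sum zero.
    have := hQm.of_quotient (Γ := A × B) ((AddMonoidHom.inr A B).comp φ)
      (fun x y h => hφ (congrArg Prod.snd h))
      ((AddMonoidHom.id A).prodMap (QuotientAddGroup.mk' φ.range))
      (Function.surjective_id.prodMap (QuotientAddGroup.mk'_surjective _)) ?_ hp.pos π h1 0 h3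
    · rw [← Nat.card_eq_fintype_card, h4] at this
      rwa [hcard]
    · rintro ⟨x, y⟩
      constructor
      · intro h
        obtain ⟨v, hv⟩ := (QuotientAddGroup.eq_zero_iff y).1 (congrArg Prod.snd h)
        exact ⟨v, Prod.ext (congrArg Prod.fst h).symm hv⟩
      · rintro ⟨v, hv⟩
        exact Prod.ext (congrArg Prod.fst hv).symm
          ((QuotientAddGroup.eq_zero_iff y).2 ⟨v, congrArg Prod.snd hv⟩)
  · have h4 : 2 ^ k = 4 := by rw [← hB, ← Nat.card_congr e.toEquiv]; simp
    rw [h4]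
    by_cases hp3 : p = 3
    · subst hp3
      have := Fact.mk Nat.prime_three
      have := isAddCyclic_of_prime_card hA
      have e3 : ZMod 3 ≃+ A := (ZMod.ringEquivCongr hA).symm.toAddEquiv.trans
        (zmodAddCyclicAddEquiv ‹IsAddCyclic A›)
      exact hasMagic_zmod_three_prod_klein.map (e3.prodCongr e)
    · exact (hasMagic_prod_klein hp hpo hp3 hA).map ((AddEquiv.refl A).prodCongr e)
  · have h8 : 2 ^ k = 8 := by rw [← hB, ← Nat.card_congr e.toEquiv]; simp
    rw [h8]
    exact (hasMagic_prod_zmod_two_pow_three hA hpo hp.one_lt).map ((AddEquiv.refl A).prodCongr e)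
  · have h2 : 2 ^ k = 2 * Nat.card C := by
      rw [← hB, ← Nat.card_congr e.toEquiv, Nat.card_prod, Nat.card_zmod]
    rw [h2]
    exact (hasMagic_prod_zmod_two_prod hA hpo hp.one_lt rfl hz hz2).map
      ((AddEquiv.refl A).prodCongr e)

theorem hasMagic_of_odd_even (n : ℕ) : ∀ (Γ : Type u) [AddCommGroup Γ] (a b : ℕ), a * b = n →
    Odd a → Even b → 1 < a → 0 < b → Nat.card Γ = a * b → HasTwoInvolutions Γ →
    HasMagic Γ a b := by
  induction n using Nat.strong_induction_on with
  | _ n ih =>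
    intro Γ _ a b hn ha hb ha1 hb0 hΓ hinv
    have : Finite Γ := Nat.finite_of_card_ne_zero (hΓ ▸ (Nat.mul_pos (by omega) hb0).ne')
    by_cases hap : a.Prime
    · by_cases hbq : ∃ q, q.Prime ∧ Odd q ∧ q ∣ b
      · obtain ⟨q, hq, hqo, d, rfl⟩ := hbq
        have hde : Even d := by
          rcases Nat.even_mul.1 hb with h | h
          · exact absurd h (Nat.not_even_iff_odd.2 hqo)
          · exact h
        have hd0 := Nat.pos_of_mul_pos_left hb0
        -- The odd prime `q` is removed from the transposed rectangle, where the Kotzig array has an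
        -- odd number `a > 1` of columns.
        refine (hasMagic_of_prime_dvd hq (by rw [hΓ]; ring) (hasKotzig_of_odd hqo ha1) fun χ hχ =>
          (ih (a * d) ?_ χ.ker a d rfl ha hde ha1 hd0 (by rw [hχ, mul_comm])
            (hinv.ker hqo χ)).symm).symm
        rw [← hn, mul_left_comm]
        exact lt_mul_left (by positivity) hq.one_lt
      · obtain ⟨k, rfl⟩ : ∃ k, b = 2 ^ k := by
          refine ⟨_, Nat.eq_prime_pow_of_unique_prime_dvd hb0.ne' fun {q} hq hqb => ?_⟩
          by_contra hq2
          exact hbq ⟨q, hq, hq.odd_of_ne_two hq2, hqb⟩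
        obtain ⟨A, B, hA, hB, ⟨e⟩⟩ := exists_prod_addEquiv_of_coprime
          ((Nat.coprime_two_right.2 ha).pow_right k) hΓ
        refine (hasMagic_prod_of_prime_of_two_pow hap ha hA hB
          ((hinv.of_injective e.symm.toAddMonoidHom e.symm.injective).of_prod_odd (hA ▸ ha))
          fun Q _ c hc hQ hQinv => ?_).map e
        have hc0 : 0 < c := by omega
        refine ih (a * c) ?_ Q a c rfl ha ?_ ha1 hc0 hQ hQinv
        · rw [← hn, hc]
          exact Nat.mul_lt_mul_of_pos_left (by omega) (by omega)
        -- The induction needs `c` even: a group with two involutions has order divisible by 4, and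
        -- `a` is odd.
        · have h4 := hQinv.four_dvd_card
          rw [hQ] at h4
          rcases Nat.even_mul.1 (even_iff_two_dvd.2 (dvd_trans (by norm_num) h4)) with h | h
          · exact absurd h (Nat.not_even_iff_odd.2 ha)
          · exact h
    · obtain ⟨p, d, hp, hd1, rfl⟩ := exists_prime_mul_of_not_prime ha1 hap
      obtain ⟨hpo, hdo⟩ := Nat.odd_mul.1 ha
      refine hasMagic_of_prime_dvd hp hΓ (hasKotzig_of_even hb) fun χ hχ =>
        ih (d * b) ?_ χ.ker d b rfl hdo hb hd1 hb0 hχ (hinv.ker hpo χ)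
      rw [← hn, mul_assoc]
      exact lt_mul_left (by positivity) hp.one_lt

theorem theorem3p9 {Γ : Type*} [AddCommGroup Γ] (a b : ℕ) (ha : 1 < a) (hb : 1 < b)
    (hΓ : Nat.card Γ = a * b) :
    (∃ x : Matrix (Fin a) (Fin b) Γ, IsMagicRectangle x) ↔
      (Even a ∧ Even b) ∨ InClassG Γ := by
  have ha0 : 0 < a := by omega
  have hb0 : 0 < b := by omega
  have : Finite Γ := Nat.finite_of_card_ne_zero (hΓ ▸ (Nat.mul_pos ha0 hb0).ne')
  have hΓ' : Nat.card Γ = b * a := by rw [hΓ, mul_comm]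
  rw [hasMagic_iff, inClassG_iff]
  rcases Nat.even_or_odd a with hae | hao <;> rcases Nat.even_or_odd b with hbe | hbo
  · exact iff_of_true (hasMagic_of_even_even _ Γ a b rfl hae hbe ha0 hb0 hΓ) (Or.inl ⟨hae, hbe⟩)
  · have h1 : ¬ Odd (Nat.card Γ) := by
      rw [hΓ, Nat.not_odd_iff_even]
      exact hae.mul_right b
    refine ⟨fun h => Or.inr (Or.inr (hasTwoInvolutions_of_hasMagic hΓ' hbo hae h.symm)), ?_⟩
    rintro (⟨-, h⟩ | h | h)
    · exact absurd h (Nat.not_even_iff_odd.2 hbo)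
    · exact absurd h h1
    · exact (hasMagic_of_odd_even _ Γ b a rfl hbo hae hb ha0 hΓ' h).symm
  · have h1 : ¬ Odd (Nat.card Γ) := by
      rw [hΓ, Nat.not_odd_iff_even]
      exact hbe.mul_left a
    refine ⟨fun h => Or.inr (Or.inr (hasTwoInvolutions_of_hasMagic hΓ hao hbe h)), ?_⟩
    rintro (⟨h, -⟩ | h | h)
    · exact absurd h (Nat.not_even_iff_odd.2 hao)
    · exact absurd h h1
    · exact hasMagic_of_odd_even _ Γ a b rfl hao hbe ha hb0 hΓ h
  · exact iff_of_true (hasMagic_of_odd_odd _ Γ a b rfl hao hbo ha hb hΓ)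
      (Or.inr (Or.inl (hΓ ▸ hao.mul hbo)))
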